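/- **Conventions.** Composition is written in diagrammatic order: $f\circ g$ is first $f$, then $g$. *C-systems.* A C-system $CC$ is a category with a length function $\ell:Ob\to\mathbb N$, a map $ft:Ob\to Ob$, a final object $pt$ which is the only object of length $0$ (with $ft(pt)=pt$, and $\ell(ft(X))=\ell(X)-1$ if $\ell(X)>0$), projections $p_X:X\to ft(X)$, and, for $\ell(X)>0$ and $f:Y\to ft(X)$, a canonical pull-back square formed by $p_{f^*(X)}:f^*(X)\to Y$, $q(f,X):f^*(X)\to X$, $f$ and $p_X$, with $\ell(f^*(X))>0$ and $ft(f^*(X))=Y$, strictly compatible with identities and composition in $f$. Put $Ob_1(\Gamma)=\{T\mid \ell(T)>0,\ ft(T)=\Gamma\}$. Let $\widetilde{Ob}(T)$ be the set of sections of $p_T$, and let $\widetilde{Ob}_1(\Gamma)$ be the set of pairs of $T\in Ob_1(\Gamma)$ and $o\in\widetilde{Ob}(T)$; write $\partial(o)=T$. Pull-back along $f:\Gamma'\to\Gamma$ acts on $Ob_1$ and $\widetilde{Ob}_1$. For $T\in Ob_1(\Gamma)$ let $\delta(T)\in\widetilde{Ob}(p_T^*(T))$ be the diagonal. *J-structures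 on a C-system.* A J0-structure is a family $IdT_\Gamma:\{(o,o')\in\widetilde{Ob}_1(\Gamma)^2\mid\partial(o)=\partial(o')\}\to Ob_1(\Gamma)$ natural in $\Gamma$. A J1-structure over it is a family $refl:\widetilde{Ob}_1(\Gamma)\to\widetilde{Ob}_1(\Gamma)$ natural in $\Gamma$ with $\partial(refl(o))=IdT(o,o)$. For $T\in Ob_1(\Gamma)$ put $$IdxT(T)=IdT\big(p_{p_T^*(T)}^*(\delta(T)),\ \delta(p_T^*(T))\big)\in Ob_1(p_T^*(T)),\qquad rf_T=refl(\delta(T))\circ q(\delta(T),IdxT(T)):T\to IdxT(T).$$ For $f:\Gamma'\to\Gamma$ let $q_3(f,T):IdxT(f^*(T))\to IdxT(T)$ be the canonical morphism over $f$. A J2-structure over $(IdT,refl)$ assigns to all $\Gamma$, $T\in Ob_1(\Gamma)$, $P\in Ob_1(IdxT(T))$, $s0\in\widetilde{Ob}(rf_T^*(P))$ an element $J(\Gamma,T,P,s0)\in\widetilde{Ob}(P)$ such that 1. (naturality) $q_3(f,T)^*(J(\Gamma,T,P,s0))=J(\Gamma',f^*(T),q_3(f,T)^*(P),q(f,T)^*(s0))$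 for all $f:\Gamma'\to\Gamma$; 2. ($\iota$-rule) $rf_T^*(J(\Gamma,T,P,s0))=s0$. A J-structure is such a triple $(IdT,refl,J)$. *Universes.* Let $\mathcal C$ be a category with a morphism $p:\widetilde U\to U$ together with a choice, for every $F:X\to U$, of a pull-back $(X;F)$ of $p$ along $F$, with projections $p_{X,F}:(X;F)\to X$ and $Q(F):(X;F)\to\widetilde U$ (a universe structure on $p$), and with a chosen final object $pt$. Iterated choices are written $(X;F_1,F_2,\dots)$; $g*h$ denotes the morphism to $(X;F)$ with components $g,h$, and for $f:X'\to X$ put $Q(f,F)=(p_{X',f\circ F}\circ f)*Q(f\circ F):(X';f\circ F)\to(X;F)$. Assume that $\mathcal C$ has a locally cartesian closed structure (chosen fiber products $\times_Z$ and relative internal Hom-objects $\underline{Hom}_Z$ with evaluation morphisms) and chosen binary products; no compatibility between the various choices is assumed. For $r:\widetilde V\to U$ put $I_r(V)=\underline{Hom}_U((\widetilde V,r),(U\times V,pr_1))$, functorial in $V$ via $I_r(f)$; a morphism $h:\widetilde V'\to\widetilde V$ over $U$ (from $r'$ to $r$) induces $I^h(V):I_r(V)\to I_{r'}(V)$. If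 $r$ has a universe structure, with pull-backs $(X;F)_r$, let $\eta_r(F,a):X\to I_r(V)$, for $F:X\to U$ and $a:(X;F)_r\to V$, be the morphism over $U$ adjoint to $a$; every morphism $X\to I_r(V)$ is of this form for a unique pair $(F,a)$. *J-structures on $p$.* A J0-structure is a morphism $Eq:(\widetilde U;p)\to U$. Put $E\widetilde U=(\widetilde U;p,Eq)$ and let $pE\widetilde U:E\widetilde U\to U$ be the composite projection, with the universe structure $$(X;F)_E=(X;F,\,Q(F)\circ p,\,Q(Q(F),p)\circ Eq),\qquad Q(F)_E=Q(Q(Q(F),p),Eq).$$ A J1-structure over $Eq$ is a morphism $\Omega:\widetilde U\to\widetilde U$ with $\Omega\circ p=\Delta\circ Eq$, where $\Delta=Id*Id:\widetilde U\to(\widetilde U;p)$; it defines $\omega=\Delta*\Omega:\widetilde U\to E\widetilde U$ over $U$. Put $Fp=(I_{pE\widetilde U}(U),I^\omega(U))\times_{I_p(U)}(I_p(\widetilde U),I_p(p))$, and let $coJ:I_{pE\widetilde U}(\widetilde U)\to Fp$ be the morphism with components $I_{pE\widetilde U}(p)$ and $I^\omega(\widetilde U)$. A J2-structure over $(Eq,\Omega)$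 is a morphism $Jp:Fp\to I_{pE\widetilde U}(\widetilde U)$ with $Jp\circ coJ=Id$. A J-structure on $p$ is such a triple $(Eq,\Omega,Jp)$. *The C-system $CC(\mathcal C,p)$.* Its objects of length $n$ are the sequences $\Gamma=(F_1,\dots,F_n)$ with $F_1:pt\to U$, $F_2:(pt;F_1)\to U$, and so on; $int(\Gamma)=(pt;F_1,\dots,F_n)$; $Hom(\Gamma',\Gamma)=Hom_{\mathcal C}(int(\Gamma'),int(\Gamma))$; $ft$ drops the last entry; $p_{(\Gamma,F)}=p_{int(\Gamma),F}$, $f^*(\Gamma,F)=(\Gamma',f\circ F)$ and $q(f,(\Gamma,F))=Q(f,F)$. There are bijections $u_1:Ob_1(\Gamma)\to Hom(int(\Gamma),U)$, $(\Gamma,F)\mapsto F$, and $\widetilde u_1:\widetilde{Ob}_1(\Gamma)\to Hom(int(\Gamma),\widetilde U)$, $o\mapsto o\circ Q(u_1(\partial(o)))$. Let $$IdT_{Eq}(o,o')=u_1^{-1}\big((\widetilde u_1(o)*\widetilde u_1(o'))\circ Eq\big),\qquad refl_\Omega(o)=\widetilde u_1^{-1}(\widetilde u_1(o)\circ\Omega).$$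 These are a J0-structure on $CC(\mathcal C,p)$ and a J1-structure over it, and $int(IdxT(T))=(int(\Gamma);u_1(T))_E$ for $T\in Ob_1(\Gamma)$. **Theorem.** Let $(Eq,\Omega,Jp)$ be a J-structure on the universe $p$. Then there is a unique J2-structure $J=J_{Jp}$ over $(IdT_{Eq},refl_\Omega)$ on $CC(\mathcal C,p)$ such that for all $\Gamma$, $T\in Ob_1(\Gamma)$, $P\in Ob_1(IdxT(T))$ and $s0\in\widetilde{Ob}(rf_T^*(P))$ there is a morphism $\phi:int(\Gamma)\to Fp$ with components $$\eta_{pE\widetilde U}(u_1(T),u_1(P))\quad\text{and}\quad \eta_p(u_1(T),\widetilde u_1(s0))$$ and $$\eta_{pE\widetilde U}\big(u_1(T),\widetilde u_1(J(\Gamma,T,P,s0))\big)=\phi\circ Jp .$$ In particular $(IdT_{Eq},refl_\Omega,J_{Jp})$ is a J-structure on $CC(\mathcal C,p)$: $J_{Jp}$ is natural in $\Gamma$ and satisfies the $\iota$-rule. -/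

import Mathlib

open CategoryTheory CategoryTheory.Limits

universe v u

noncomputable section

/-! ## C-systems -/

/-- The length and father functions underlying a C-system. -/
structure CSystemData where
  Ob : Type u
  [cat : Category.{v} Ob]
  len : Ob → ℕ
  pt : Ob
  ft : Ob → Ob

attribute [instance] CSystemData.cat

/-- `Ob₁(Γ)`: the objects `T` with `ft T = Γ` and `ℓ(T) > 0`. -/
structure CSystemData.Ob1 (S : CSystemData.{v, u}) (Γ : S.Ob) where
  obj : S.Ob
  len_pos : 0 < S.len obj
  ft_eq : S.ft obj = Γ

/-- A C-system (contextual category).  The canonical projection `p_T : T ⟶ ft T` and the canonical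
square of `T` and `f : Δ ⟶ ft T` are indexed by `Γ` and `T ∈ Ob₁(Γ)`, so that `Γ = ft T`; the
projection of the object of length `0` is the identity and is left out.  The section operation
`f ↦ s_f` of a C-system exists, and is then unique, if and only if the canonical squares are
pullback squares. -/
structure CSystem extends CSystemData.{v, u} where
  len_eq_zero : ∀ X : Ob, len X = 0 ↔ X = pt
  len_ft : ∀ X : Ob, 0 < len X → len (ft X) = len X - 1
  ft_pt : ft pt = pt
  pt_terminal : Nonempty (IsTerminal pt)
  /-- the canonical projection `p_T : T ⟶ Γ` -/
  p : ∀ {Γ : Ob} (T : toCSystemData.Ob1 Γ), T.obj ⟶ Γ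
  /-- the object `f^*(T)` -/
  pb : ∀ {Δ Γ : Ob} (_ : Δ ⟶ Γ) (_ : toCSystemData.Ob1 Γ), toCSystemData.Ob1 Δ
  /-- the morphism `q(f, T) : f^*(T) ⟶ T` -/
  q : ∀ {Δ Γ : Ob} (f : Δ ⟶ Γ) (T : toCSystemData.Ob1 Γ), (pb f T).obj ⟶ T.obj
  isPullback : ∀ {Δ Γ : Ob} (f : Δ ⟶ Γ) (T : toCSystemData.Ob1 Γ),
    IsPullback (p (pb f T)) (q f T) f (p T)
  pb_id : ∀ {Γ : Ob} (T : toCSystemData.Ob1 Γ), pb (𝟙 Γ) T = T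
  q_id : ∀ {Γ : Ob} (T : toCSystemData.Ob1 Γ),
    q (𝟙 Γ) T = eqToHom (congrArg CSystemData.Ob1.obj (pb_id T))
  pb_comp : ∀ {Δ' Δ Γ : Ob} (g : Δ' ⟶ Δ) (f : Δ ⟶ Γ) (T : toCSystemData.Ob1 Γ),
    pb (g ≫ f) T = pb g (pb f T)
  q_comp : ∀ {Δ' Δ Γ : Ob} (g : Δ' ⟶ Δ) (f : Δ ⟶ Γ) (T : toCSystemData.Ob1 Γ),
    q (g ≫ f) T = eqToHom (congrArg CSystemData.Ob1.obj (pb_comp g f T)) ≫ q g (pb f T) ≫ q f T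

namespace CSystem

variable {S : CSystem.{v, u}}

/-- The morphism `q(f, T)` with its source `f^*(T)` replaced by an equal object `T'`. -/
def qOf {Δ Γ : S.Ob} {f : Δ ⟶ Γ} {T : S.Ob1 Γ} {T' : S.Ob1 Δ} (h : S.pb f T = T') :
    T'.obj ⟶ T.obj :=
  eqToHom (congrArg CSystemData.Ob1.obj h.symm) ≫ S.q f T

theorem qOf_rfl {Δ Γ : S.Ob} (f : Δ ⟶ Γ) (T : S.Ob1 Γ) : qOf (rfl : S.pb f T = _) = S.q f T := by
  simp [qOf]

theorem qOf_isPullback {Δ Γ : S.Ob} {f : Δ ⟶ Γ} {T : S.Ob1 Γ} {T' : S.Ob1 Δ}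
    (h : S.pb f T = T') : IsPullback (S.p T') (qOf h) f (S.p T) := by
  subst h
  rw [qOf_rfl]
  exact S.isPullback f T

theorem qOf_id {Γ : S.Ob} (T : S.Ob1 Γ) (h : S.pb (𝟙 Γ) T = T) : qOf h = 𝟙 T.obj := by
  simp [qOf, S.q_id]

theorem qOf_comp {Δ' Δ Γ : S.Ob} {g : Δ' ⟶ Δ} {f : Δ ⟶ Γ} {T : S.Ob1 Γ} {T' : S.Ob1 Δ}
    {T'' : S.Ob1 Δ'} (h₁ : S.pb f T = T') (h₂ : S.pb g T' = T'') (h : S.pb (g ≫ f) T = T'') :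
    qOf h₂ ≫ qOf h₁ = qOf h := by
  subst h₁ h₂
  simp [qOf, S.q_comp]

theorem qOf_congr {Δ Γ : S.Ob} {f f' : Δ ⟶ Γ} {T : S.Ob1 Γ} {T' : S.Ob1 Δ} (e : f = f')
    (h : S.pb f T = T') (h' : S.pb f' T = T') : qOf h = qOf h' := by
  subst e; rfl

/-- An element of `Õb₁(Γ)`: an object `∂(o) ∈ Ob₁(Γ)` with a section of its projection. -/
structure Sec (S : CSystem.{v, u}) (Γ : S.Ob) where
  /-- the boundary `∂(o)` -/
  bd : S.Ob1 Γ
  s : Γ ⟶ bd.obj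
  w : s ≫ S.p bd = 𝟙 Γ

/-- The section `f^*(o)`, the unique one with `f^*(o) ∘ q(f, ∂(o)) = f ∘ o` in diagrammatic order. -/
abbrev Sec.pb {Δ Γ : S.Ob} (f : Δ ⟶ Γ) (o : S.Sec Γ) : S.Sec Δ where
  bd := S.pb f o.bd
  s := (S.isPullback f o.bd).lift (𝟙 Δ) (f ≫ o.s) (by simp [o.w])
  w := by simp

theorem Sec.pb_s_q {Δ Γ : S.Ob} (f : Δ ⟶ Γ) (o : S.Sec Γ) :
    (o.pb f).s ≫ S.q f o.bd = f ≫ o.s := by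
  simp [Sec.pb]

theorem Sec.ext_qOf {Δ Γ : S.Ob} {f : Δ ⟶ Γ} {T : S.Ob1 Γ} {o o' : S.Sec Δ}
    (h : S.pb f T = o.bd) (h' : S.pb f T = o'.bd) (e : o.s ≫ qOf h = o'.s ≫ qOf h') : o = o' := by
  obtain ⟨b, s, w⟩ := o
  obtain ⟨b', s', w'⟩ := o'
  dsimp only at h h' e
  subst h
  subst h'
  have : s = s' := (S.isPullback f T).hom_ext (w.trans w'.symm) (by simpa [qOf_rfl] using e)
  subst this
  rfl

theorem Sec.pb_comp {Δ' Δ Γ : S.Ob} (g : Δ' ⟶ Δ) (f : Δ ⟶ Γ) (o : S.Sec Γ) :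
    o.pb (g ≫ f) = (o.pb f).pb g := by
  refine Sec.ext_qOf (f := g ≫ f) (T := o.bd) rfl (S.pb_comp g f o.bd) ?_
  rw [qOf_rfl, Sec.pb_s_q, ← qOf_comp (rfl : S.pb f o.bd = _) (rfl : S.pb g (S.pb f o.bd) = _),
    qOf_rfl, qOf_rfl, ← Category.assoc]
  rw [Sec.pb_s_q g (o.pb f)]
  rw [Category.assoc, Category.assoc, Sec.pb_s_q]

theorem Sec.pb_id {Γ : S.Ob} (o : S.Sec Γ) : o.pb (𝟙 Γ) = o := by
  refine Sec.ext_qOf (f := 𝟙 Γ) (T := o.bd) rfl (S.pb_id o.bd) ?_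
  rw [qOf_rfl, Sec.pb_s_q, qOf_id]
  simp

/-- The diagonal `δ(T) ∈ Õb(p_T^*(T))`. -/
abbrev diag {Γ : S.Ob} (T : S.Ob1 Γ) : S.Sec T.obj where
  bd := S.pb (S.p T) T
  s := (S.isPullback (S.p T) T).lift (𝟙 _) (𝟙 _) rfl
  w := by simp

theorem diag_s_q {Γ : S.Ob} (T : S.Ob1 Γ) : (diag T).s ≫ S.q (S.p T) T = 𝟙 T.obj := by
  simp [diag]

theorem pb_diag {Γ : S.Ob} (o : S.Sec Γ) : (diag o.bd).pb o.s = o := by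
  have h : S.pb o.s (S.pb (S.p o.bd) o.bd) = o.bd := by rw [← S.pb_comp, o.w, S.pb_id]
  have h1 : S.pb (o.s ≫ S.p o.bd) o.bd = S.pb o.s (S.pb (S.p o.bd) o.bd) := S.pb_comp _ _ _
  have h2 : S.pb (o.s ≫ S.p o.bd) o.bd = o.bd := h1.trans h
  refine Sec.ext_qOf (f := o.s ≫ S.p o.bd) (T := o.bd) h1 h2 ?_
  rw [qOf_congr o.w h2 (S.pb_id _), qOf_id,
    ← qOf_comp (rfl : S.pb (S.p o.bd) o.bd = _) (rfl : S.pb o.s _ = _) h1, qOf_rfl, qOf_rfl,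
    ← Category.assoc]
  rw [Sec.pb_s_q o.s (diag o.bd)]
  rw [Category.assoc, diag_s_q]

/-- `q(f, T, 2)`-compatibility: `q(f,T)^*(p_T^*(T)) = p_{f^*(T)}^*(f^*(T))`. -/
theorem pb_qOf_pb {Δ Γ : S.Ob} {f : Δ ⟶ Γ} {T : S.Ob1 Γ} {T' : S.Ob1 Δ} (h : S.pb f T = T') :
    S.pb (qOf h) (S.pb (S.p T) T) = S.pb (S.p T') T' := by
  rw [← S.pb_comp, ← (qOf_isPullback h).w, S.pb_comp, h]

theorem diag_pb_qOf {Δ Γ : S.Ob} {f : Δ ⟶ Γ} {T : S.Ob1 Γ} {T' : S.Ob1 Δ} (h : S.pb f T = T') :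
    (diag T).pb (qOf h) = diag T' := by
  have h1 : S.pb (qOf h ≫ S.p T) T = S.pb (qOf h) (S.pb (S.p T) T) := S.pb_comp _ _ _
  have h2 : S.pb (qOf h ≫ S.p T) T = S.pb (S.p T') T' := h1.trans (pb_qOf_pb h)
  have h3 : S.pb (S.p T' ≫ f) T = S.pb (S.p T') T' := by rw [S.pb_comp, h]
  refine Sec.ext_qOf (f := qOf h ≫ S.p T) (T := T) h1 h2 ?_
  have e1 : qOf h2 = S.q (S.p T') T' ≫ qOf h := by
    rw [qOf_congr (qOf_isPullback h).w.symm h2 h3, ← qOf_comp h rfl h3, qOf_rfl]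
  rw [e1, ← Category.assoc, diag_s_q,
    ← qOf_comp (rfl : S.pb (S.p T) T = _) (rfl : S.pb (qOf h) _ = _) h1, qOf_rfl, qOf_rfl,
    ← Category.assoc]
  rw [Sec.pb_s_q (qOf h) (diag T)]
  rw [Category.assoc, diag_s_q]
  simp

/-! ### J-structures on a C-system -/

/-- A J0-structure on a C-system. -/
structure J0Structure (S : CSystem.{v, u}) where
  IdT : ∀ {Γ : S.Ob} (o o' : S.Sec Γ), o.bd = o'.bd → S.Ob1 Γ
  natural : ∀ {Γ' Γ : S.Ob} (f : Γ' ⟶ Γ) (o o' : S.Sec Γ) (h : o.bd = o'.bd),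
    S.pb f (IdT o o' h) = IdT (o.pb f) (o'.pb f) (congrArg (S.pb f) h)

/-- A J1-structure over a J0-structure. -/
structure J1Structure (I : J0Structure S) where
  refl : ∀ {Γ : S.Ob}, S.Sec Γ → S.Sec Γ
  natural : ∀ {Γ' Γ : S.Ob} (f : Γ' ⟶ Γ) (o : S.Sec Γ), (refl o).pb f = refl (o.pb f)
  bd_refl : ∀ {Γ : S.Ob} (o : S.Sec Γ), (refl o).bd = I.IdT o o rfl

namespace J0Structure

variable (I : J0Structure S)

/-- `IdxT(T) ∈ Ob₃(Γ)`, as an element of `Ob₁(p_T^*(T))`. -/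
def IdxT {Γ : S.Ob} (T : S.Ob1 Γ) : S.Ob1 (S.pb (S.p T) T).obj :=
  I.IdT ((diag T).pb (S.p (S.pb (S.p T) T))) (diag (S.pb (S.p T) T)) rfl

theorem IdT_congr {Γ : S.Ob} {o₁ o₁' o₂ o₂' : S.Sec Γ} (h₁ : o₁ = o₁') (h₂ : o₂ = o₂')
    (h : o₁.bd = o₂.bd) (h' : o₁'.bd = o₂'.bd) : I.IdT o₁ o₂ h = I.IdT o₁' o₂' h' := by
  subst h₁ h₂; rfl

theorem pb_diag_IdxT {Γ : S.Ob} (T : S.Ob1 Γ) :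
    S.pb (diag T).s (I.IdxT T) = I.IdT (diag T) (diag T) rfl := by
  refine (I.natural _ _ _ _).trans (I.IdT_congr ?_ (pb_diag (diag T)) _ _)
  rw [← Sec.pb_comp]
  rw [(diag T).w]
  exact Sec.pb_id _

/-- The morphism `q(f, p_T^*(T), 2) : p_{f^*(T)}^*(f^*(T)) ⟶ p_T^*(T)`. -/
def q2 {Γ' Γ : S.Ob} (f : Γ' ⟶ Γ) (T : S.Ob1 Γ) :
    (S.pb (S.p (S.pb f T)) (S.pb f T)).obj ⟶ (S.pb (S.p T) T).obj :=
  qOf (pb_qOf_pb (rfl : S.pb f T = _))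

theorem pb_q2_IdxT {Γ' Γ : S.Ob} (f : Γ' ⟶ Γ) (T : S.Ob1 Γ) :
    S.pb (q2 f T) (I.IdxT T) = I.IdxT (S.pb f T) := by
  refine (I.natural _ _ _ _).trans (I.IdT_congr ?_ (diag_pb_qOf _) _ _)
  rw [← Sec.pb_comp]
  unfold q2
  rw [← (qOf_isPullback (pb_qOf_pb (rfl : S.pb f T = _))).w, Sec.pb_comp, diag_pb_qOf]

/-- The morphism `q(f, IdxT(T), 3) : IdxT(f^*(T)) = f^*(IdxT(T), 3) ⟶ IdxT(T)`. -/
def q3 {Γ' Γ : S.Ob} (f : Γ' ⟶ Γ) (T : S.Ob1 Γ) : (I.IdxT (S.pb f T)).obj ⟶ (I.IdxT T).obj :=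
  qOf (I.pb_q2_IdxT f T)

end J0Structure

namespace J1Structure

variable {I : J0Structure S} (R : J1Structure I)

/-- The morphism `rf_T = refl(δ(T)) ∘ q(δ(T), IdxT(T)) : T ⟶ IdxT(T)` (diagrammatic order). -/
def rf {Γ : S.Ob} (T : S.Ob1 Γ) : T.obj ⟶ (I.IdxT T).obj :=
  (R.refl (diag T)).s ≫ qOf ((I.pb_diag_IdxT T).trans (R.bd_refl (diag T)).symm)

theorem rf_natural {Γ' Γ : S.Ob} (f : Γ' ⟶ Γ) (T : S.Ob1 Γ) :
    R.rf (S.pb f T) ≫ I.q3 f T = S.q f T ≫ R.rf T := by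
  have hd : (diag T).pb (S.q f T) = diag (S.pb f T) := by
    simpa [qOf_rfl] using diag_pb_qOf (rfl : S.pb f T = _)
  have hs : (diag (S.pb f T)).s ≫ J0Structure.q2 f T = S.q f T ≫ (diag T).s := by
    refine (S.isPullback (S.p T) T).hom_ext ?_ ?_
    · have e : S.p (S.pb (S.p (S.pb f T)) (S.pb f T)) ≫ S.q f T =
          J0Structure.q2 f T ≫ S.p (S.pb (S.p T) T) := by
        rw [← qOf_rfl]
        exact (qOf_isPullback (pb_qOf_pb (rfl : S.pb f T = _))).w
      have w1 := (diag (S.pb f T)).w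
      have w2 := (diag T).w
      rw [Category.assoc, Category.assoc, ← e, reassoc_of% w1, w2, Category.comp_id]
    · have h1 : S.pb (qOf (rfl : S.pb f T = _) ≫ S.p T) T = S.pb (S.p (S.pb f T)) (S.pb f T) := by
        rw [← (qOf_isPullback _).w, S.pb_comp]
      have h2 : S.pb (S.p (S.pb f T) ≫ f) T = S.pb (S.p (S.pb f T)) (S.pb f T) := S.pb_comp _ _ _
      have e : J0Structure.q2 f T ≫ S.q (S.p T) T =
          S.q (S.p (S.pb f T)) (S.pb f T) ≫ S.q f T := by
        unfold J0Structure.q2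
        rw [← qOf_rfl (S.p T) T, qOf_comp _ _ h1, qOf_congr (qOf_isPullback _).w.symm h1 h2,
          ← qOf_comp rfl rfl h2, qOf_rfl, qOf_rfl]
      rw [Category.assoc, Category.assoc, e, diag_s_q, ← Category.assoc, diag_s_q]
      simp
  have key : ∀ (o : S.Sec (S.pb f T).obj) (_ : (R.refl (diag T)).pb (S.q f T) = o)
      (h : S.pb (S.q f T ≫ (diag T).s) (I.IdxT T) = o.bd),
      o.s ≫ qOf h = S.q f T ≫ R.rf T := by
    intro o ho h
    subst ho
    rw [← qOf_comp ((I.pb_diag_IdxT T).trans (R.bd_refl (diag T)).symm) rfl h, qOf_rfl,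
      ← Category.assoc, Sec.pb_s_q, Category.assoc]
    rfl
  have hb : S.pb ((diag (S.pb f T)).s ≫ J0Structure.q2 f T) (I.IdxT T) =
      (R.refl (diag (S.pb f T))).bd := by
    rw [S.pb_comp, I.pb_q2_IdxT]
    exact (I.pb_diag_IdxT _).trans (R.bd_refl _).symm
  unfold rf J0Structure.q3
  rw [Category.assoc, qOf_comp _ _ hb, qOf_congr hs hb (hs ▸ hb)]
  exact key _ ((R.natural _ _).trans (congrArg R.refl hd)) _

/-- The boundary of `f^*(s0)` is `rf_{f^*(T)}^*(f^*(P))`. -/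
theorem pb_bd {Γ' Γ : S.Ob} (f : Γ' ⟶ Γ) {T : S.Ob1 Γ} {P : S.Ob1 (I.IdxT T).obj}
    {s0 : S.Sec T.obj} (h : s0.bd = S.pb (R.rf T) P) :
    (s0.pb (S.q f T)).bd = S.pb (R.rf (S.pb f T)) (S.pb (I.q3 f T) P) := by
  rw [← S.pb_comp, R.rf_natural, S.pb_comp, ← h]

end J1Structure

/-- A J2-structure over a J1-structure: for all `Γ`, `T ∈ Ob₁(Γ)`, `P ∈ Ob₁(IdxT(T))` and
`s0 ∈ Õb(rf_T^*(P))` an element `J(Γ, T, P, s0)` of `Õb(P)`, natural in `Γ` and satisfying the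
`ι`-rule.  Here `f^*(P)`, `f^*(s0)` and `f^*(J)` are `q(f, IdxT(T), 3)^*(P)`, `q(f, T)^*(s0)` and
`q(f, IdxT(T), 3)^*(J)`. -/
@[ext]
structure J2Structure {I : J0Structure S} (R : J1Structure I) where
  J : ∀ {Γ : S.Ob} (T : S.Ob1 Γ) (P : S.Ob1 (I.IdxT T).obj) (s0 : S.Sec T.obj),
    s0.bd = S.pb (R.rf T) P → S.Sec (I.IdxT T).obj
  bd_J : ∀ {Γ : S.Ob} (T : S.Ob1 Γ) (P : S.Ob1 (I.IdxT T).obj) (s0 : S.Sec T.obj)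
    (h : s0.bd = S.pb (R.rf T) P), (J T P s0 h).bd = P
  natural : ∀ {Γ' Γ : S.Ob} (f : Γ' ⟶ Γ) (T : S.Ob1 Γ) (P : S.Ob1 (I.IdxT T).obj)
    (s0 : S.Sec T.obj) (h : s0.bd = S.pb (R.rf T) P),
    (J T P s0 h).pb (I.q3 f T) =
      J (S.pb f T) (S.pb (I.q3 f T) P) (s0.pb (S.q f T)) (R.pb_bd f h)
  iota : ∀ {Γ : S.Ob} (T : S.Ob1 Γ) (P : S.Ob1 (I.IdxT T).obj) (s0 : S.Sec T.obj)
    (h : s0.bd = S.pb (R.rf T) P), (J T P s0 h).pb (R.rf T) = s0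

end CSystem

/-! ## Universes -/

section Categories

variable {C : Type u} [Category.{v} C]

/-- A universe structure on `p : Ũ ⟶ U`: a choice of pull-back squares along all `F : X ⟶ U`. -/
structure Universe {Ut U : C} (p : Ut ⟶ U) where
  /-- the object `(X; F)` -/
  obj : ∀ {X : C}, (X ⟶ U) → C
  /-- the projection `p_{X,F}` -/
  proj : ∀ {X : C} (F : X ⟶ U), obj F ⟶ X
  Q : ∀ {X : C} (F : X ⟶ U), obj F ⟶ Ut
  isPullback : ∀ {X : C} (F : X ⟶ U), IsPullback (proj F) (Q F) F p

namespace Universe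

variable {Ut U : C} {p : Ut ⟶ U} (W : Universe p)

/-- The morphism `f * g : Y ⟶ (X; F)`. -/
def lift {X Y : C} {F : X ⟶ U} (f : Y ⟶ X) (g : Y ⟶ Ut) (h : f ≫ F = g ≫ p) : Y ⟶ W.obj F :=
  (W.isPullback F).lift f g h

@[simp]
theorem lift_proj {X Y : C} {F : X ⟶ U} (f : Y ⟶ X) (g : Y ⟶ Ut) (h : f ≫ F = g ≫ p) :
    W.lift f g h ≫ W.proj F = f := (W.isPullback F).lift_fst f g h

@[simp]
theorem lift_Q {X Y : C} {F : X ⟶ U} (f : Y ⟶ X) (g : Y ⟶ Ut) (h : f ≫ F = g ≫ p) :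
    W.lift f g h ≫ W.Q F = g := (W.isPullback F).lift_snd f g h

theorem hom_ext {X Y : C} {F : X ⟶ U} {f g : Y ⟶ W.obj F} (h₁ : f ≫ W.proj F = g ≫ W.proj F)
    (h₂ : f ≫ W.Q F = g ≫ W.Q F) : f = g := (W.isPullback F).hom_ext h₁ h₂

/-- The morphism `Q(f, F) : (X'; f ∘ F) ⟶ (X; F)`. -/
def Qmap {X' X : C} (f : X' ⟶ X) (F : X ⟶ U) : W.obj (f ≫ F) ⟶ W.obj F :=
  W.lift (W.proj (f ≫ F) ≫ f) (W.Q (f ≫ F)) (by simpa using (W.isPullback (f ≫ F)).w)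

@[simp]
theorem Qmap_proj {X' X : C} (f : X' ⟶ X) (F : X ⟶ U) :
    W.Qmap f F ≫ W.proj F = W.proj (f ≫ F) ≫ f := by simp [Qmap]

@[simp]
theorem Qmap_Q {X' X : C} (f : X' ⟶ X) (F : X ⟶ U) : W.Qmap f F ≫ W.Q F = W.Q (f ≫ F) := by
  simp [Qmap]

theorem Qmap_isPullback {X' X : C} (f : X' ⟶ X) (F : X ⟶ U) :
    IsPullback (W.proj (f ≫ F)) (W.Qmap f F) f (W.proj F) :=
  (IsPullback.of_right (by simpa using (W.isPullback (f ≫ F)).flip) (W.Qmap_proj f F)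
    (W.isPullback F).flip).flip

/-! ### J0- and J1-structures on a universe -/

/-- A J0-structure on a universe: a morphism `Eq : (Ũ; p) ⟶ U`. -/
abbrev J0Structure : Type v := W.obj p ⟶ U

/-- The diagonal `Δ = Id * Id : Ũ ⟶ (Ũ; p)`. -/
def diag : Ut ⟶ W.obj p := W.lift (𝟙 Ut) (𝟙 Ut) rfl

/-- A J1-structure over `Eq`: a morphism `Ω : Ũ ⟶ Ũ` over `Δ ∘ Eq` (diagrammatic order). -/
structure J1Structure (Eq : W.J0Structure) where
  Ω : Ut ⟶ Ut
  comm : Ω ≫ p = W.diag ≫ Eq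

variable (Eq : W.J0Structure)

/-- The object `EŨ = (Ũ; p, Eq)`. -/
abbrev E : C := W.obj Eq

/-- The projection `pEŨ : EŨ ⟶ U`. -/
def pE : W.E Eq ⟶ U := W.proj Eq ≫ W.proj p ≫ p

/-- The universe structure on `pEŨ` given by concatenation of three canonical squares:
`(X; F)_E = (X; F, Q(F) ∘ p, Q(Q(F), p) ∘ Eq)` and `Q(F)_E = Q(Q(Q(F), p), Eq)`. -/
def universeE : Universe (W.pE Eq) where
  obj F := W.obj (W.Qmap (W.Q F) p ≫ Eq)
  proj F := W.proj (W.Qmap (W.Q F) p ≫ Eq) ≫ W.proj (W.Q F ≫ p) ≫ W.proj F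
  Q F := W.Qmap (W.Qmap (W.Q F) p) Eq
  isPullback F := ((W.Qmap_isPullback (W.Qmap (W.Q F) p) Eq).flip.paste_vert
    ((W.Qmap_isPullback (W.Q F) p).flip.paste_vert (W.isPullback F).flip)).flip

variable {W Eq}

/-- The morphism `ω : Ũ ⟶ EŨ` defined by the square of a J1-structure. -/
def J1Structure.ω (O : W.J1Structure Eq) : Ut ⟶ W.E Eq := W.lift W.diag O.Ω O.comm.symm

theorem J1Structure.ω_pE (O : W.J1Structure Eq) : O.ω ≫ W.pE Eq = p := by
  unfold J1Structure.ω pE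
  rw [← Category.assoc, lift_proj, ← Category.assoc, diag, lift_proj, Category.id_comp]

end Universe

/-! ## Locally cartesian closed structures and the functors `I_p` -/

variable (C) in
/-- A locally cartesian closed structure: chosen fiber squares for all pairs of morphisms with a
common codomain, and, for all `f : X ⟶ Z` and `g : Y ⟶ Z`, a chosen internal Hom-object
`Hom_Z((X, f), (Y, g))` over `Z` with an evaluation morphism over `Z` that is universal. -/
structure LCCStructure where
  /-- the fiber product `(X, f) ×_Z (Y, g)` -/
  fp : ∀ {X Y Z : C}, (X ⟶ Z) → (Y ⟶ Z) → C
  fst : ∀ {X Y Z : C} (f : X ⟶ Z) (g : Y ⟶ Z), fp f g ⟶ X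
  snd : ∀ {X Y Z : C} (f : X ⟶ Z) (g : Y ⟶ Z), fp f g ⟶ Y
  isPullback : ∀ {X Y Z : C} (f : X ⟶ Z) (g : Y ⟶ Z), IsPullback (fst f g) (snd f g) f g
  /-- the internal Hom-object from `(X, f)` to `(Y, g)` over `Z` -/
  hom : ∀ {X Y Z : C}, (X ⟶ Z) → (Y ⟶ Z) → C
  homProj : ∀ {X Y Z : C} (f : X ⟶ Z) (g : Y ⟶ Z), hom f g ⟶ Z
  ev : ∀ {X Y Z : C} (f : X ⟶ Z) (g : Y ⟶ Z), fp (homProj f g) f ⟶ Y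
  ev_comp : ∀ {X Y Z : C} (f : X ⟶ Z) (g : Y ⟶ Z),
    ev f g ≫ g = fst (homProj f g) f ≫ homProj f g
  existsUnique_curry : ∀ {X Y Z : C} (f : X ⟶ Z) (g : Y ⟶ Z) {A : C} (w : A ⟶ Z)
    (a : fp w f ⟶ Y), a ≫ g = fst w f ≫ w → ∃! b : A ⟶ hom f g, ∃ hb : b ≫ homProj f g = w,
      (isPullback (homProj f g) f).lift (fst w f ≫ b) (snd w f)
        (by rw [Category.assoc, hb, (isPullback w f).w]) ≫ ev f g = a

variable (C) in
/-- A choice of binary products. -/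
structure BinaryProductStructure where
  prod : C → C → C
  fst : ∀ X Y : C, prod X Y ⟶ X
  snd : ∀ X Y : C, prod X Y ⟶ Y
  isLimit : ∀ X Y : C, IsLimit (BinaryFan.mk (fst X Y) (snd X Y))

namespace BinaryProductStructure

variable (B : BinaryProductStructure C)

/-- The morphism into the product with the given components. -/
def lift {A X Y : C} (f : A ⟶ X) (g : A ⟶ Y) : A ⟶ B.prod X Y :=
  BinaryFan.IsLimit.lift (B.isLimit X Y) f g

@[simp]
theorem lift_fst {A X Y : C} (f : A ⟶ X) (g : A ⟶ Y) : B.lift f g ≫ B.fst X Y = f :=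
  BinaryFan.IsLimit.lift_fst (B.isLimit X Y) f g

@[simp]
theorem lift_snd {A X Y : C} (f : A ⟶ X) (g : A ⟶ Y) : B.lift f g ≫ B.snd X Y = g :=
  BinaryFan.IsLimit.lift_snd (B.isLimit X Y) f g

theorem hom_ext {A X Y : C} {f g : A ⟶ B.prod X Y} (h₁ : f ≫ B.fst X Y = g ≫ B.fst X Y)
    (h₂ : f ≫ B.snd X Y = g ≫ B.snd X Y) : f = g :=
  BinaryFan.IsLimit.hom_ext (B.isLimit X Y) h₁ h₂

end BinaryProductStructure

namespace LCCStructure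

variable (L : LCCStructure C)

/-- The morphism `a × h` between fiber products over `Z`. -/
def fpMap {X X' Y Y' Z : C} {f : X ⟶ Z} {f' : X' ⟶ Z} {g : Y ⟶ Z} {g' : Y' ⟶ Z} (a : X ⟶ X')
    (ha : a ≫ f' = f) (h : Y ⟶ Y') (hh : h ≫ g' = g) : L.fp f g ⟶ L.fp f' g' :=
  (L.isPullback f' g').lift (L.fst f g ≫ a) (L.snd f g ≫ h)
    (by rw [Category.assoc, Category.assoc, ha, hh, (L.isPullback f g).w])

@[simp]
theorem fpMap_fst {X X' Y Y' Z : C} {f : X ⟶ Z} {f' : X' ⟶ Z} {g : Y ⟶ Z} {g' : Y' ⟶ Z}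
    (a : X ⟶ X') (ha : a ≫ f' = f) (h : Y ⟶ Y') (hh : h ≫ g' = g) :
    L.fpMap a ha h hh ≫ L.fst f' g' = L.fst f g ≫ a := by simp [fpMap]

@[simp]
theorem fpMap_snd {X X' Y Y' Z : C} {f : X ⟶ Z} {f' : X' ⟶ Z} {g : Y ⟶ Z} {g' : Y' ⟶ Z}
    (a : X ⟶ X') (ha : a ≫ f' = f) (h : Y ⟶ Y') (hh : h ≫ g' = g) :
    L.fpMap a ha h hh ≫ L.snd f' g' = L.snd f g ≫ h := by simp [fpMap]

theorem fpMap_comp {X X' X'' Y Y' Y'' Z : C} {f : X ⟶ Z} {f' : X' ⟶ Z} {f'' : X'' ⟶ Z}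
    {g : Y ⟶ Z} {g' : Y' ⟶ Z} {g'' : Y'' ⟶ Z} (a : X ⟶ X') (ha : a ≫ f' = f) (h : Y ⟶ Y')
    (hh : h ≫ g' = g) (a' : X' ⟶ X'') (ha' : a' ≫ f'' = f') (h' : Y' ⟶ Y'') (hh' : h' ≫ g'' = g') :
    L.fpMap a ha h hh ≫ L.fpMap a' ha' h' hh' =
      L.fpMap (a ≫ a') (by rw [Category.assoc, ha', ha]) (h ≫ h')
        (by rw [Category.assoc, hh', hh]) := by
  refine (L.isPullback _ _).hom_ext ?_ ?_ <;> simp [reassoc_of% fpMap_fst, reassoc_of% fpMap_snd]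

variable {X Y Z : C} {f : X ⟶ Z} {g : Y ⟶ Z} {A : C} {w : A ⟶ Z}

/-- The adjoint `A ⟶ Hom_Z((X, f), (Y, g))` of a morphism `(A, w) ×_Z (X, f) ⟶ (Y, g)` over `Z`. -/
def curry (a : L.fp w f ⟶ Y) (ha : a ≫ g = L.fst w f ≫ w) : A ⟶ L.hom f g :=
  (L.existsUnique_curry f g w a ha).choose

@[simp]
theorem curry_homProj (a : L.fp w f ⟶ Y) (ha : a ≫ g = L.fst w f ≫ w) :
    L.curry a ha ≫ L.homProj f g = w :=
  (L.existsUnique_curry f g w a ha).choose_spec.1.1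

/-- The adjoint of a morphism `(A, w) ⟶ Hom_Z((X, f), (Y, g))` over `Z`. -/
def uncurry (b : A ⟶ L.hom f g) (hb : b ≫ L.homProj f g = w) : L.fp w f ⟶ Y :=
  L.fpMap b hb (𝟙 X) (Category.id_comp f) ≫ L.ev f g

theorem uncurry_eq (b : A ⟶ L.hom f g) (hb : b ≫ L.homProj f g = w) :
    (L.isPullback (L.homProj f g) f).lift (L.fst w f ≫ b) (L.snd w f)
      (by rw [Category.assoc, hb, (L.isPullback w f).w]) ≫ L.ev f g = L.uncurry b hb := by
  unfold uncurry
  congr 1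
  refine (L.isPullback _ _).hom_ext ?_ ?_ <;> simp

theorem uncurry_comp (b : A ⟶ L.hom f g) (hb : b ≫ L.homProj f g = w) :
    L.uncurry b hb ≫ g = L.fst w f ≫ w := by
  rw [uncurry, Category.assoc, L.ev_comp, ← Category.assoc, fpMap_fst, Category.assoc, hb]

theorem uncurry_curry (a : L.fp w f ⟶ Y) (ha : a ≫ g = L.fst w f ≫ w) :
    L.uncurry (L.curry a ha) (L.curry_homProj a ha) = a := by
  obtain ⟨hb, e⟩ := (L.existsUnique_curry f g w a ha).choose_spec.1
  rw [← uncurry_eq]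
  exact e

theorem eq_of_uncurry_eq {b b' : A ⟶ L.hom f g} (hb : b ≫ L.homProj f g = w)
    (hb' : b' ≫ L.homProj f g = w) (e : L.uncurry b hb = L.uncurry b' hb') : b = b' :=
  (L.existsUnique_curry f g w (L.uncurry b hb) (L.uncurry_comp b hb)).unique
    ⟨hb, L.uncurry_eq b hb⟩ ⟨hb', (L.uncurry_eq b' hb').trans e.symm⟩

end LCCStructure

section I

variable (L : LCCStructure C) (B : BinaryProductStructure C) {Ut U : C} (p : Ut ⟶ U)

theorem LCCStructure.uncurry_comp_curry {X Y Z A A' : C} {f : X ⟶ Z} {g : Y ⟶ Z} {w : A ⟶ Z}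
    (b : A' ⟶ A) (a : L.fp w f ⟶ Y) (ha : a ≫ g = L.fst w f ≫ w) {w' : A' ⟶ Z} (hw : b ≫ w = w')
    (hb : (b ≫ L.curry a ha) ≫ L.homProj f g = w') :
    L.uncurry (b ≫ L.curry a ha) hb = L.fpMap b hw (𝟙 X) (Category.id_comp f) ≫ a := by
  conv_rhs => rw [← L.uncurry_curry a ha, LCCStructure.uncurry, ← Category.assoc, L.fpMap_comp]
  rw [LCCStructure.uncurry]
  congr 1
  refine (L.isPullback _ _).hom_ext ?_ ?_ <;> simp

/-- The object `I_p(V) = Hom_U((Ũ, p), (U × V, pr₁))`. -/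
def I (V : C) : C := L.hom p (B.fst U V)

/-- The projection `prI_p(V) : I_p(V) ⟶ U`. -/
def prI (V : C) : I L B p V ⟶ U := L.homProj p (B.fst U V)

/-- The evaluation morphism `(I_p(V), prI_p(V)) ×_U (Ũ, p) ⟶ U × V`. -/
def evI (V : C) : L.fp (prI L B p V) p ⟶ B.prod U V := L.ev p (B.fst U V)

theorem evI_fst (V : C) : evI L B p V ≫ B.fst U V = L.fst (prI L B p V) p ≫ prI L B p V :=
  L.ev_comp p (B.fst U V)

/-- The functor `I_p` on morphisms. -/
def IMap {V V' : C} (f : V ⟶ V') : I L B p V ⟶ I L B p V' :=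
  L.curry (w := prI L B p V)
    (evI L B p V ≫ B.lift (B.fst U V) (B.snd U V ≫ f))
    (by rw [Category.assoc, B.lift_fst, evI_fst])

/-- The morphism `I^h(V) : I_p(V) ⟶ I_{p'}(V)` defined by `h : Ũ' ⟶ Ũ` over `U`. -/
def IPre {Ut' : C} {p' : Ut' ⟶ U} (h : Ut' ⟶ Ut) (hh : h ≫ p = p') (V : C) :
    I L B p V ⟶ I L B p' V :=
  L.curry (w := prI L B p V)
    (L.fpMap (𝟙 _) (Category.id_comp _) h hh ≫ evI L B p V)
    (by rw [Category.assoc, evI_fst, ← Category.assoc, L.fpMap_fst, Category.comp_id])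

theorem IMap_prI {V V' : C} (f : V ⟶ V') : IMap L B p f ≫ prI L B p V' = prI L B p V :=
  L.curry_homProj _ _

theorem IPre_prI {Ut' : C} {p' : Ut' ⟶ U} (h : Ut' ⟶ Ut) (hh : h ≫ p = p') (V : C) :
    IPre L B p h hh V ≫ prI L B p' V = prI L B p V :=
  L.curry_homProj _ _

theorem IMap_IPre {Ut' : C} {p' : Ut' ⟶ U} (h : Ut' ⟶ Ut) (hh : h ≫ p = p') {V V' : C}
    (f : V ⟶ V') :
    IMap L B p f ≫ IPre L B p h hh V' = IPre L B p h hh V ≫ IMap L B p' f := by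
  have h1 : (IMap L B p f ≫ IPre L B p h hh V') ≫ prI L B p' V' = prI L B p V := by
    rw [Category.assoc, IPre_prI, IMap_prI]
  have h2 : (IPre L B p h hh V ≫ IMap L B p' f) ≫ prI L B p' V' = prI L B p V := by
    rw [Category.assoc, IMap_prI, IPre_prI]
  refine L.eq_of_uncurry_eq h1 h2 ?_
  have e1 := L.uncurry_comp_curry (IMap L B p f)
    (L.fpMap (𝟙 _) (Category.id_comp _) h hh ≫ evI L B p V')
    (by rw [Category.assoc, evI_fst, ← Category.assoc, L.fpMap_fst, Category.comp_id])
    (IMap_prI L B p f) h1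
  have e2 := L.uncurry_comp_curry (IPre L B p h hh V)
    (evI L B p' V ≫ B.lift (B.fst U V) (B.snd U V ≫ f))
    (by rw [Category.assoc, B.lift_fst, evI_fst]) (IPre_prI L B p h hh V) h2
  have e3 : L.fpMap (IMap L B p f) (IMap_prI L B p f) (𝟙 Ut) (Category.id_comp p) ≫ evI L B p V' =
      evI L B p V ≫ B.lift (B.fst U V) (B.snd U V ≫ f) := L.uncurry_curry _ _
  have e4 : L.fpMap (IPre L B p h hh V) (IPre_prI L B p h hh V) (𝟙 Ut') (Category.id_comp p') ≫
      evI L B p' V = L.fpMap (𝟙 _) (Category.id_comp _) h hh ≫ evI L B p V := L.uncurry_curry _ _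
  refine e1.trans (Eq.trans ?_ e2.symm)
  rw [reassoc_of% e4, ← e3, ← Category.assoc, ← Category.assoc]
  congr 1
  refine (L.isPullback _ _).hom_ext ?_ ?_ <;>
    simp [reassoc_of% L.fpMap_fst, reassoc_of% L.fpMap_snd]

end I

namespace Universe

variable {Ut U : C} {p : Ut ⟶ U} (W : Universe p) (L : LCCStructure C)
  (B : BinaryProductStructure C)

/-- The set `D_p(X, V)` of pairs of `F : X ⟶ U` and a morphism `(X; F) ⟶ V`. -/
def D (X V : C) : Type v := Σ F : X ⟶ U, (W.obj F ⟶ V)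

/-- The morphism `st_p(V) : (I_p(V); prI_p(V)) ⟶ V`. -/
def st (V : C) : W.obj (prI L B p V) ⟶ V :=
  (L.isPullback (prI L B p V) p).lift (W.proj _) (W.Q _) (W.isPullback _).w ≫
    evI L B p V ≫ B.snd U V

/-- The map `η^!_{p,X,V} : Hom(X, I_p(V)) → D_p(X, V)`. -/
def etaShriek {X V : C} (g : X ⟶ I L B p V) : W.D X V :=
  ⟨g ≫ prI L B p V, W.Qmap g (prI L B p V) ≫ W.st L B V⟩

/-- The map `η_{p,X,V} : D_p(X, V) → Hom(X, I_p(V))`, inverse to `η^!_{p,X,V}`: the adjoint of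
`(X, F) ×_U (Ũ, p) ≅ (X; F) ⟶ V`, as a morphism to `(U × V, pr₁)` over `U`. -/
def eta {X V : C} (F : X ⟶ U) (a : W.obj F ⟶ V) : X ⟶ I L B p V :=
  L.curry (w := F)
    (B.lift (L.fst F p ≫ F) (W.lift (L.fst F p) (L.snd F p) (L.isPullback F p).w ≫ a))
    (B.lift_fst _ _)

theorem eta_prI {X V : C} (F : X ⟶ U) (a : W.obj F ⟶ V) :
    W.eta L B F a ≫ prI L B p V = F := L.curry_homProj _ _

theorem D_ext {X V : C} {d d' : W.D X V} (h : d.1 = d'.1)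
    (e : W.lift (W.proj d.1) (W.Q d.1) (by rw [← h]; exact (W.isPullback d.1).w) ≫ d'.2 = d.2) :
    d = d' := by
  obtain ⟨F, a⟩ := d
  obtain ⟨F', a'⟩ := d'
  dsimp only at h e
  subst h
  congr 1
  rw [← e]
  have : W.lift (W.proj F) (W.Q F) (W.isPullback F).w = 𝟙 _ := W.hom_ext (by simp) (by simp)
  rw [this, Category.id_comp]

theorem etaShriek_eta {X V : C} (F : X ⟶ U) (a : W.obj F ⟶ V) :
    W.etaShriek L B (W.eta L B F a) = ⟨F, a⟩ := by
  refine W.D_ext (W.eta_prI L B F a) ?_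
  have e : L.fpMap (W.eta L B F a) (W.eta_prI L B F a) (𝟙 Ut) (Category.id_comp p) ≫
      evI L B p V = B.lift (L.fst F p ≫ F)
        (W.lift (L.fst F p) (L.snd F p) (L.isPullback F p).w ≫ a) := L.uncurry_curry _ _
  have h : W.proj (W.eta L B F a ≫ prI L B p V) ≫ F = W.Q (W.eta L B F a ≫ prI L B p V) ≫ p :=
    (congrArg (W.proj _ ≫ ·) (W.eta_prI L B F a)).symm.trans (W.isPullback _).w
  have e' : W.Qmap (W.eta L B F a) (prI L B p V) ≫
      (L.isPullback (prI L B p V) p).lift (W.proj _) (W.Q _) (W.isPullback _).w =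
      (L.isPullback F p).lift (W.proj _) (W.Q _) h ≫
        L.fpMap (W.eta L B F a) (W.eta_prI L B F a) (𝟙 Ut) (Category.id_comp p) := by
    refine (L.isPullback _ _).hom_ext ?_ ?_ <;> simp
  simp only [etaShriek, st]
  rw [reassoc_of% e', reassoc_of% e, B.lift_snd, ← Category.assoc]
  congr 1
  refine W.hom_ext ?_ ?_ <;> simp

theorem eta_etaShriek {X V : C} (g : X ⟶ I L B p V) :
    W.eta L B (W.etaShriek L B g).1 (W.etaShriek L B g).2 = g := by
  refine L.eq_of_uncurry_eq (W.eta_prI L B _ _) (rfl : g ≫ prI L B p V = _) ?_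
  refine (L.uncurry_curry _ _).trans (B.hom_ext ?_ ?_)
  · rw [B.lift_fst]
    exact (L.uncurry_comp g rfl).symm
  · rw [B.lift_snd]
    simp only [etaShriek, st, LCCStructure.uncurry]
    change _ = (L.fpMap (f' := prI L B p V) g rfl (𝟙 Ut) (Category.id_comp p) ≫ evI L B p V) ≫ _
    rw [← Category.assoc, ← Category.assoc, ← Category.assoc]
    congr 2
    refine (L.isPullback (prI L B p V) p).hom_ext ?_ ?_ <;>
      simp [reassoc_of% W.lift_proj]

/-- The bijection `η_{p,X,V}`. -/
def etaEquiv (X V : C) : W.D X V ≃ (X ⟶ I L B p V) where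
  toFun d := W.eta L B d.1 d.2
  invFun := W.etaShriek L B
  left_inv d := W.etaShriek_eta L B d.1 d.2
  right_inv := W.eta_etaShriek L B

/-! ### J2-structures on a universe -/

variable {W} {Eq : W.J0Structure} (O : W.J1Structure Eq)

/-- The object `Fp = (I_{pEŨ}(U), I^ω(U)) ×_{I_p(U)} (I_p(Ũ), I_p(p))`. -/
abbrev Fp : C := L.fp (IPre L B (W.pE Eq) O.ω O.ω_pE U) (IMap L B p p)

/-- The morphism `coJ : I_{pEŨ}(Ũ) ⟶ Fp` with components `I_{pEŨ}(p)` and `I^ω(Ũ)`. -/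
def coJ : I L B (W.pE Eq) Ut ⟶ Fp L B O :=
  (L.isPullback (IPre L B (W.pE Eq) O.ω O.ω_pE U) (IMap L B p p)).lift
    (IMap L B (W.pE Eq) p) (IPre L B (W.pE Eq) O.ω O.ω_pE Ut) (IMap_IPre L B _ _ _ _)

/-- A J2-structure over `(Eq, Ω)`: a section `Jp` of `coJ`. -/
structure J2Structure where
  Jp : Fp L B O ⟶ I L B (W.pE Eq) Ut
  comp_coJ : Jp ≫ coJ L B O = 𝟙 _

end Universe

/-! ## The C-system of a universe category -/

variable (C) in
/-- A universe category: a universe `p : Ũ ⟶ U` and a choice of a final object `pt`. -/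
structure UniverseCategory where
  {Ut : C}
  {U : C}
  p : Ut ⟶ U
  univ : Universe p
  pt : C
  pt_terminal : IsTerminal pt

variable (𝒰 : UniverseCategory C)

namespace UniverseCategory

/-- The objects `Γ` of `CC(𝒞, p)`, indexed by the object `int(Γ)`: sequences `(F₁, …, Fₙ)` with
`F₁ : pt ⟶ U`, `F₂ : (pt; F₁) ⟶ U`, `F₃ : (pt; F₁, F₂) ⟶ U` and so on. -/
inductive Ctx : C → Type (max u v)
  | nil : Ctx 𝒰.pt
  | cons {X : C} (Γ : Ctx X) (F : X ⟶ 𝒰.U) : Ctx (𝒰.univ.obj F)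

/-- The objects of `CC(𝒞, p)`. -/
structure CCOb where
  int : C
  ctx : 𝒰.Ctx int

variable {𝒰}

/-- The length of a sequence. -/
def Ctx.len : ∀ {X : C}, 𝒰.Ctx X → ℕ
  | _, .nil => 0
  | _, .cons Γ _ => Γ.len + 1

/-- `ft` removes the last member of a sequence, if there is one. -/
def CCOb.ft : 𝒰.CCOb → 𝒰.CCOb
  | ⟨_, .nil⟩ => ⟨_, .nil⟩
  | ⟨_, .cons Γ _⟩ => ⟨_, Γ⟩

/-- Morphisms from `Γ'` to `Γ` are the morphisms from `int(Γ')` to `int(Γ)`. -/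
instance : Category.{v} 𝒰.CCOb where
  Hom Γ' Γ := Γ'.int ⟶ Γ.int
  id Γ := 𝟙 Γ.int
  comp f g := f ≫ g

variable (𝒰) in
/-- The objects, lengths and father function of `CC(𝒞, p)`. -/
abbrev CCData : CSystemData.{v, max u v} where
  Ob := 𝒰.CCOb
  len Γ := Γ.ctx.len
  pt := ⟨𝒰.pt, .nil⟩
  ft := CCOb.ft

/-- The extension `(Γ, F)` of `Γ` by `F : int(Γ) ⟶ U`. -/
def ext (Γ : 𝒰.CCOb) (F : Γ.int ⟶ 𝒰.U) : 𝒰.CCData.Ob1 Γ where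
  obj := ⟨𝒰.univ.obj F, .cons Γ.ctx F⟩
  len_pos := Nat.succ_pos _
  ft_eq := rfl

/-- Every element of `Ob₁(Γ)` is of the form `(Γ, F)`. -/
@[elab_as_elim]
def Ob1.elim {Γ : 𝒰.CCOb} {motive : 𝒰.CCData.Ob1 Γ → Sort*}
    (h : ∀ F : Γ.int ⟶ 𝒰.U, motive (ext Γ F)) : ∀ T, motive T
  | ⟨⟨_, .nil⟩, hl, _⟩ => absurd hl (Nat.lt_irrefl 0)
  | ⟨⟨_, .cons _ F⟩, _, e⟩ => by
    change CCOb.mk _ _ = Γ at e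
    subst e
    exact h F

/-- The bijection `u₁ : Ob₁(Γ) → Hom(int(Γ), U)`, inverse to `F ↦ (Γ, F)`. -/
def u1 {Γ : 𝒰.CCOb} (T : 𝒰.CCData.Ob1 Γ) : Γ.int ⟶ 𝒰.U :=
  Ob1.elim (motive := fun _ => Γ.int ⟶ 𝒰.U) (fun F => F) T

theorem u1_ext {Γ : 𝒰.CCOb} (F : Γ.int ⟶ 𝒰.U) : u1 (ext Γ F) = F := rfl

theorem ext_u1 {Γ : 𝒰.CCOb} (T : 𝒰.CCData.Ob1 Γ) : ext Γ (u1 T) = T := by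
  induction T using Ob1.elim with
  | h F => rfl

theorem int_obj {Γ : 𝒰.CCOb} (T : 𝒰.CCData.Ob1 Γ) : T.obj.int = 𝒰.univ.obj (u1 T) := by
  induction T using Ob1.elim with
  | h F => rfl

/-- The projection `p_T`, equal to `p_{int(Γ),F}` for `T = (Γ, F)`. -/
def projT {Γ : 𝒰.CCOb} (T : 𝒰.CCData.Ob1 Γ) : T.obj.int ⟶ Γ.int :=
  Ob1.elim (motive := fun T => T.obj.int ⟶ Γ.int) (fun F => 𝒰.univ.proj F) T

/-- The morphism `Q(u₁(T)) : int(T) ⟶ Ũ`. -/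
def QT {Γ : 𝒰.CCOb} (T : 𝒰.CCData.Ob1 Γ) : T.obj.int ⟶ 𝒰.Ut :=
  Ob1.elim (motive := fun T => T.obj.int ⟶ 𝒰.Ut) (fun F => 𝒰.univ.Q F) T

theorem T_isPullback {Γ : 𝒰.CCOb} (T : 𝒰.CCData.Ob1 Γ) :
    IsPullback (projT T) (QT T) (u1 T) 𝒰.p := by
  induction T using Ob1.elim with
  | h F => exact 𝒰.univ.isPullback F

/-- The morphism `q(f, T)`, equal to `Q(f, F)` for `T = (Γ, F)`. -/
def qT {Δ Γ : 𝒰.CCOb} (f : Δ.int ⟶ Γ.int) (T : 𝒰.CCData.Ob1 Γ) :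
    (ext Δ (f ≫ u1 T)).obj.int ⟶ T.obj.int :=
  Ob1.elim (motive := fun T => (ext Δ (f ≫ u1 T)).obj.int ⟶ T.obj.int) (fun F => 𝒰.univ.Qmap f F) T

theorem qT_projT {Δ Γ : 𝒰.CCOb} (f : Δ.int ⟶ Γ.int) (T : 𝒰.CCData.Ob1 Γ) :
    qT f T ≫ projT T = projT (ext Δ (f ≫ u1 T)) ≫ f := by
  induction T using Ob1.elim with
  | h F => exact 𝒰.univ.Qmap_proj f F

theorem qT_QT {Δ Γ : 𝒰.CCOb} (f : Δ.int ⟶ Γ.int) (T : 𝒰.CCData.Ob1 Γ) :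
    qT f T ≫ QT T = QT (ext Δ (f ≫ u1 T)) := by
  induction T using Ob1.elim with
  | h F => exact 𝒰.univ.Qmap_Q f F

theorem eqToHom_projT {Γ : 𝒰.CCOb} {T T' : 𝒰.CCData.Ob1 Γ} (h : T = T') :
    eqToHom (congrArg (fun T => CCOb.int (CSystemData.Ob1.obj T)) h) ≫ projT T' = projT T := by
  subst h; simp

theorem eqToHom_QT {Γ : 𝒰.CCOb} {T T' : 𝒰.CCData.Ob1 Γ} (h : T = T') :
    eqToHom (congrArg (fun T => CCOb.int (CSystemData.Ob1.obj T)) h) ≫ QT T' = QT T := by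
  subst h; simp

theorem eqToHom_CC {Γ Γ' : 𝒰.CCOb} (h : Γ = Γ') :
    (eqToHom h : Γ ⟶ Γ') = (eqToHom (congrArg CCOb.int h) : Γ.int ⟶ Γ'.int) := by
  subst h; rfl

theorem isPullback_CC {P X Y Z : 𝒰.CCOb} {a : P ⟶ X} {b : P ⟶ Y} {f : X ⟶ Z} {g : Y ⟶ Z}
    (h : IsPullback (C := C) a b f g) : IsPullback a b f g :=
  IsPullback.mk' h.w (fun _ _ _ h₁ h₂ => h.hom_ext h₁ h₂) (fun _ x y e => h.exists_lift x y e)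

theorem ext_comp {Δ' Δ Γ : 𝒰.CCOb} (g : Δ'.int ⟶ Δ.int) (f : Δ.int ⟶ Γ.int)
    (T : 𝒰.CCData.Ob1 Γ) : ext Δ' ((g ≫ f) ≫ u1 T) = ext Δ' (g ≫ u1 (ext Δ (f ≫ u1 T))) :=
  congrArg (ext _) (Category.assoc g f (u1 T))

theorem qT_comp {Δ' Δ Γ : 𝒰.CCOb} (g : Δ'.int ⟶ Δ.int) (f : Δ.int ⟶ Γ.int)
    (T : 𝒰.CCData.Ob1 Γ) : qT (g ≫ f) T =
      eqToHom (congrArg (fun T => CCOb.int (CSystemData.Ob1.obj T)) (ext_comp g f T)) ≫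
        qT g (ext Δ (f ≫ u1 T)) ≫ qT f T := by
  have e1 := eqToHom_projT (ext_comp g f T)
  refine (T_isPullback T).hom_ext ?_ ?_
  · conv_rhs => rw [Category.assoc (eqToHom _), Category.assoc (qT _ _)]
    rw [qT_projT, qT_projT f T, reassoc_of% qT_projT g (ext Δ (f ≫ u1 T)), reassoc_of% e1]
  · conv_rhs => rw [Category.assoc (eqToHom _), Category.assoc (qT _ _)]
    rw [qT_QT, qT_QT f T, qT_QT g (ext Δ (f ≫ u1 T)), eqToHom_QT (ext_comp g f T)]

theorem ext_id {Γ : 𝒰.CCOb} (T : 𝒰.CCData.Ob1 Γ) : ext Γ (𝟙 Γ.int ≫ u1 T) = T :=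
  (congrArg (ext Γ) (Category.id_comp (u1 T))).trans (ext_u1 T)

theorem qT_id {Γ : 𝒰.CCOb} (T : 𝒰.CCData.Ob1 Γ) : qT (𝟙 Γ.int) T =
    eqToHom (congrArg (fun T => CCOb.int (CSystemData.Ob1.obj T)) (ext_id T)) := by
  refine (T_isPullback T).hom_ext ?_ ?_
  · rw [qT_projT, eqToHom_projT (ext_id T), Category.comp_id]
  · rw [qT_QT, eqToHom_QT (ext_id T)]

variable (𝒰) in
/-- The C-system `CC(𝒞, p)`. -/
abbrev CC : CSystem.{v, max u v} where
  toCSystemData := 𝒰.CCData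
  len_eq_zero X := by
    obtain ⟨X, Γ⟩ := X
    cases Γ with
    | nil => simp [Ctx.len]
    | cons Γ F =>
      simp only [Ctx.len, Nat.add_eq_zero_iff, one_ne_zero, and_false, false_iff]
      intro h
      have := congrArg (fun Y : 𝒰.CCOb => Y.ctx.len) h
      simp [Ctx.len] at this
  len_ft X h := by
    obtain ⟨X, Γ⟩ := X
    cases Γ with
    | nil => exact absurd h (Nat.lt_irrefl 0)
    | cons Γ F => simp [CCOb.ft, Ctx.len]
  ft_pt := rfl
  pt_terminal := ⟨IsTerminal.ofUniqueHom (fun X => 𝒰.pt_terminal.from X.int)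
    (fun _ _ => 𝒰.pt_terminal.hom_ext _ _)⟩
  p := projT
  pb {Δ _} f T := ext Δ (f ≫ u1 T : Δ.int ⟶ 𝒰.U)
  q := qT
  isPullback f T := isPullback_CC (by
    refine (IsPullback.of_right (h₁₂ := QT T) (h₂₂ := u1 T) (v₁₃ := 𝒰.p) ?_ (qT_projT f T)
      (T_isPullback T).flip).flip
    rw [qT_QT]
    exact (T_isPullback (ext _ _)).flip)
  pb_id T := ext_id T
  q_id T := (qT_id T).trans (eqToHom_CC _).symm
  pb_comp := ext_comp
  q_comp g f T := (qT_comp g f T).trans (congrArg (· ≫ (qT g _ ≫ qT f T)) (eqToHom_CC _).symm)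

/-- The action on morphisms of the functor `int : CC(𝒞, p) ⥤ 𝒞`. -/
def intMap {Γ' Γ : 𝒰.CCOb} (f : Γ' ⟶ Γ) : Γ'.int ⟶ Γ.int := f

/-- The bijection `ũ₁ : Õb₁(Γ) → Hom(int(Γ), Ũ)`, `o ↦ o ∘ Q(u₁(∂(o)))` (diagrammatic order). -/
def u1t {Γ : 𝒰.CCOb} (o : 𝒰.CC.Sec Γ) : Γ.int ⟶ 𝒰.Ut := intMap o.s ≫ QT o.bd

theorem u1t_p {Γ : 𝒰.CCOb} (o : 𝒰.CC.Sec Γ) : u1t o ≫ 𝒰.p = u1 o.bd := by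
  have w : intMap o.s ≫ projT o.bd = 𝟙 Γ.int := o.w
  rw [u1t, Category.assoc, ← (T_isPullback o.bd).w, reassoc_of% w]

theorem u1t_pb {Δ Γ : 𝒰.CCOb} (f : Δ ⟶ Γ) (o : 𝒰.CC.Sec Γ) :
    u1t (o.pb f) = intMap f ≫ u1t o := by
  have e : intMap (o.pb f).s ≫ qT (intMap f) o.bd = intMap f ≫ intMap o.s :=
    CSystem.Sec.pb_s_q (S := 𝒰.CC) f o
  have e' : QT (o.pb f).bd = qT (intMap f) o.bd ≫ QT o.bd := (qT_QT _ _).symm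
  calc u1t (o.pb f) = intMap (o.pb f).s ≫ qT (intMap f) o.bd ≫ QT o.bd :=
        congrArg (intMap (o.pb f).s ≫ ·) e'
    _ = (intMap (o.pb f).s ≫ qT (intMap f) o.bd) ≫ QT o.bd := (Category.assoc _ _ _).symm
    _ = (intMap f ≫ intMap o.s) ≫ QT o.bd := congrArg (· ≫ QT o.bd) e
    _ = intMap f ≫ u1t o := Category.assoc _ _ _

theorem u1t_diag {Γ : 𝒰.CCOb} (T : 𝒰.CCData.Ob1 Γ) : u1t (CSystem.diag (S := 𝒰.CC) T) = QT T := by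
  have e : intMap (CSystem.diag (S := 𝒰.CC) T).s ≫ qT (projT T) T = 𝟙 _ :=
    CSystem.diag_s_q (S := 𝒰.CC) T
  have e' : QT (CSystem.diag (S := 𝒰.CC) T).bd = qT (projT T) T ≫ QT T := (qT_QT _ _).symm
  calc u1t (CSystem.diag (S := 𝒰.CC) T) =
        intMap (CSystem.diag (S := 𝒰.CC) T).s ≫ qT (projT T) T ≫ QT T :=
        congrArg (intMap (CSystem.diag (S := 𝒰.CC) T).s ≫ ·) e'
    _ = (intMap (CSystem.diag (S := 𝒰.CC) T).s ≫ qT (projT T) T) ≫ QT T :=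
        (Category.assoc _ _ _).symm
    _ = 𝟙 _ ≫ QT T := congrArg (· ≫ QT T) e
    _ = QT T := Category.id_comp _

theorem u1t_injective {Γ : 𝒰.CCOb} {o o' : 𝒰.CC.Sec Γ} (h : u1t o = u1t o') : o = o' := by
  have hb : o.bd = o'.bd := by rw [← ext_u1 o.bd, ← ext_u1 o'.bd, ← u1t_p, ← u1t_p, h]
  obtain ⟨b, s, w⟩ := o
  obtain ⟨b', s', w'⟩ := o'
  dsimp only at hb
  subst hb
  have : s = s' := (T_isPullback b).hom_ext (w.trans w'.symm) h
  subst this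
  rfl

/-- The inverse of `ũ₁`. -/
def ofU1t {Γ : 𝒰.CCOb} (a : Γ.int ⟶ 𝒰.Ut) : 𝒰.CC.Sec Γ where
  bd := ext Γ (a ≫ 𝒰.p)
  s := 𝒰.univ.lift (𝟙 Γ.int) a (Category.id_comp _)
  w := 𝒰.univ.lift_proj _ _ _

theorem u1t_ofU1t {Γ : 𝒰.CCOb} (a : Γ.int ⟶ 𝒰.Ut) : u1t (ofU1t a) = a :=
  𝒰.univ.lift_Q _ _ _

/-- The morphism `ũ₁(o) * ũ₁(o') : int(Γ) ⟶ (Ũ; p)`. -/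
def uut {Γ : 𝒰.CCOb} (o o' : 𝒰.CC.Sec Γ) (h : o.bd = o'.bd) : Γ.int ⟶ 𝒰.univ.obj 𝒰.p :=
  𝒰.univ.lift (u1t o) (u1t o') (by rw [u1t_p, u1t_p, h])

/-- The J0-structure `IdT_Eq` on `CC(𝒞, p)`. -/
def IdTEq (Eq : 𝒰.univ.J0Structure) : 𝒰.CC.J0Structure where
  IdT {Γ} o o' h := ext Γ (uut o o' h ≫ Eq)
  natural {Γ' Γ} f o o' h := by
    have e : uut (o.pb f) (o'.pb f) (congrArg (𝒰.CC.pb f) h) = intMap f ≫ uut o o' h :=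
      𝒰.univ.hom_ext (by simp [uut, u1t_pb]) (by simp [uut, u1t_pb])
    rw [e]
    exact congrArg (ext Γ') (Category.assoc (intMap f) (uut o o' h) Eq).symm

/-- The J1-structure `refl_Ω` over `IdT_Eq` on `CC(𝒞, p)`. -/
def reflΩ {Eq : 𝒰.univ.J0Structure} (O : 𝒰.univ.J1Structure Eq) :
    CSystem.J1Structure (𝒰.IdTEq Eq) where
  refl o := ofU1t (u1t o ≫ O.Ω)
  natural f o := u1t_injective (by rw [u1t_pb, u1t_ofU1t, u1t_ofU1t, u1t_pb, Category.assoc])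
  bd_refl {Γ} o := by
    refine congrArg (ext Γ) ?_
    have e : uut o o rfl = u1t o ≫ 𝒰.univ.diag :=
      𝒰.univ.hom_ext (by simp [uut, Universe.diag]) (by simp [uut, Universe.diag])
    rw [Category.assoc, O.comm, e, Category.assoc]

theorem obj_comp_eq (Eq : 𝒰.univ.J0Structure) {X : C} {A A' : X ⟶ 𝒰.U} (h : A = A') {k : X ⟶ 𝒰.Ut}
    {G : 𝒰.univ.obj A ⟶ 𝒰.univ.obj 𝒰.p} {G' : 𝒰.univ.obj A' ⟶ 𝒰.univ.obj 𝒰.p}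
    (h₁ : G ≫ 𝒰.univ.proj 𝒰.p = 𝒰.univ.proj A ≫ k) (h₂ : G ≫ 𝒰.univ.Q 𝒰.p = 𝒰.univ.Q A)
    (h₁' : G' ≫ 𝒰.univ.proj 𝒰.p = 𝒰.univ.proj A' ≫ k) (h₂' : G' ≫ 𝒰.univ.Q 𝒰.p = 𝒰.univ.Q A') :
    𝒰.univ.obj (G ≫ Eq) = 𝒰.univ.obj (G' ≫ Eq) := by
  subst h
  rw [𝒰.univ.hom_ext (h₁.trans h₁'.symm) (h₂.trans h₂'.symm)]

/-- The equality `int(IdxT(T)) = (int(Γ); u₁(T))_E`. -/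
theorem int_IdxT (Eq : 𝒰.univ.J0Structure) {Γ : 𝒰.CCOb} (T : 𝒰.CCData.Ob1 Γ) :
    ((𝒰.IdTEq Eq).IdxT T).obj.int = (𝒰.univ.universeE Eq).obj (u1 T) := by
  induction T using Ob1.elim with
  | h F =>
    refine obj_comp_eq Eq (k := 𝒰.univ.Q F) (𝒰.univ.isPullback F).w ?_ ?_
      (𝒰.univ.Qmap_proj _ _) (𝒰.univ.Qmap_Q _ _)
    · refine (𝒰.univ.lift_proj _ _ _).trans ((u1t_pb _ _).trans ?_)
      exact congrArg (𝒰.univ.proj _ ≫ ·) (u1t_diag (ext Γ F))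
    · exact (𝒰.univ.lift_Q _ _ _).trans (u1t_diag _)

end UniverseCategory

end Categories
end

/-!
Under `η`, a morphism `X ⟶ Fp` over `F : X ⟶ U` is a pair of morphisms `a : (X; F)_E ⟶ U` and
`b : (X; F) ⟶ Ũ` that form a commutative square with `p` and the pull-back `ωPb F` of `ω` along
`F`, and a morphism `X ⟶ I_{pEŨ}(Ũ)` over `F` is a morphism `c : (X; F)_E ⟶ Ũ`.  In these terms
`coJ` sends `c` to the pair of its composites with `p` and with `ωPb F`.  Hence a section `Jp` of
`coJ` is a choice of diagonal fillers of such squares (`J2Structure.diagonal_comp`,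
`J2Structure.ωPb_comp_diagonal`), stable under change of `X` (`J2Structure.pbMap_comp_diagonal`).
These facts follow from the naturality of `η` in the source, the target and the universe
(`comp_eta`, `eta_comp_IMap`, `eta_comp_IPre`).

On the other side, along the equalities of objects `int(T) = (int(Γ); u₁(T))` and
`int(IdxT(T)) = (int(Γ); u₁(T))_E`, the morphism `rf_T` becomes `ωPb (u₁ T)`
(`intMap_rf_idxHom`) and `q_3(f, T)` becomes the canonical morphism between the pull-backs of `EŨ`
(`intMap_q3_idxHom`).  So the data `(P, s0)` of an elimination problem are such a square, and a
solution `J(Γ, T, P, s0)`, given through `ũ₁`, is a diagonal filler.  The boundary of `J` is one of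
the two triangles, the `ι`-rule is the other, and naturality is the stability of the fillers.
Uniqueness holds because `η` and `ũ₁` are injective.
-/

noncomputable section

namespace Universe

/-! ### Naturality of `η` -/

variable {C : Type u} [Category.{v} C] {Ut U : C} {p : Ut ⟶ U} (W : Universe p)
  (L : LCCStructure C) (B : BinaryProductStructure C)

/-- The morphism `Q(f, F) : (X'; F') ⟶ (X; F)` for any `F'` equal to `f ∘ F` (diagrammatic
order). -/
def pbMap {X' X : C} (f : X' ⟶ X) {F : X ⟶ U} {F' : X' ⟶ U} (h : f ≫ F = F') :
    W.obj F' ⟶ W.obj F :=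
  W.lift (W.proj F' ≫ f) (W.Q F') (by rw [Category.assoc, h, (W.isPullback F').w])

@[simp]
theorem pbMap_proj {X' X : C} (f : X' ⟶ X) {F : X ⟶ U} {F' : X' ⟶ U} (h : f ≫ F = F') :
    W.pbMap f h ≫ W.proj F = W.proj F' ≫ f := W.lift_proj _ _ _

@[simp]
theorem pbMap_Q {X' X : C} (f : X' ⟶ X) {F : X ⟶ U} {F' : X' ⟶ U} (h : f ≫ F = F') :
    W.pbMap f h ≫ W.Q F = W.Q F' := W.lift_Q _ _ _

/-- Naturality of `η` in the source. -/
theorem comp_eta {X' X V : C} (g : X' ⟶ X) {F : X ⟶ U} {F' : X' ⟶ U} (hF : g ≫ F = F')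
    (a : W.obj F ⟶ V) : g ≫ W.eta L B F a = W.eta L B F' (W.pbMap g hF ≫ a) := by
  have h : (g ≫ W.eta L B F a) ≫ prI L B p V = F' := by
    rw [Category.assoc, W.eta_prI L B F a, hF]
  refine L.eq_of_uncurry_eq h (W.eta_prI L B _ _) ?_
  refine (L.uncurry_comp_curry g _ (B.lift_fst _ _) hF h).trans
    (Eq.trans ?_ (L.uncurry_curry _ (B.lift_fst _ _)).symm)
  refine B.hom_ext ?_ ?_
  · rw [Category.assoc, B.lift_fst, B.lift_fst, ← Category.assoc, L.fpMap_fst, Category.assoc, hF]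
  · rw [Category.assoc, B.lift_snd, B.lift_snd, ← Category.assoc, ← Category.assoc]
    congr 1
    refine W.hom_ext ?_ ?_ <;> simp [reassoc_of% W.lift_proj]

/-- Naturality of `η` in the target. -/
theorem eta_comp_IMap {X V V' : C} (F : X ⟶ U) (a : W.obj F ⟶ V) (f : V ⟶ V') :
    W.eta L B F a ≫ IMap L B p f = W.eta L B F (a ≫ f) := by
  have h : (W.eta L B F a ≫ IMap L B p f) ≫ prI L B p V' = F := by
    rw [Category.assoc, IMap_prI, eta_prI]
  refine L.eq_of_uncurry_eq h (W.eta_prI L B _ _) ?_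
  refine (L.uncurry_comp_curry (W.eta L B F a) _
    (by rw [Category.assoc, B.lift_fst, evI_fst]) (W.eta_prI L B F a) h).trans
    (Eq.trans ?_ (L.uncurry_curry _ (B.lift_fst _ _)).symm)
  have e : L.fpMap (W.eta L B F a) (W.eta_prI L B F a) (𝟙 Ut) (Category.id_comp p) ≫
      evI L B p V = B.lift (L.fst F p ≫ F)
        (W.lift (L.fst F p) (L.snd F p) (L.isPullback F p).w ≫ a) := L.uncurry_curry _ _
  rw [reassoc_of% e]
  exact B.hom_ext (by simp) (by simp [reassoc_of% B.lift_snd])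

/-- The base change `(X; F)' ⟶ (X; F)` along `F` of a morphism `h : Ũ' ⟶ Ũ` over `U`. -/
def baseChange {Ut' : C} {p' : Ut' ⟶ U} (W' : Universe p') (h : Ut' ⟶ Ut) (hh : h ≫ p = p')
    {X : C} (F : X ⟶ U) : W'.obj F ⟶ W.obj F :=
  W.lift (W'.proj F) (W'.Q F ≫ h) (by rw [Category.assoc, hh, (W'.isPullback F).w])

/-- Naturality of `η` in the universe: `I^h` is precomposition with the pull-back of `h`. -/
theorem eta_comp_IPre {Ut' : C} {p' : Ut' ⟶ U} (W' : Universe p') (h : Ut' ⟶ Ut)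
    (hh : h ≫ p = p') {X V : C} (F : X ⟶ U) (a : W.obj F ⟶ V) :
    W.eta L B F a ≫ IPre L B p h hh V = W'.eta L B F (W.baseChange W' h hh F ≫ a) := by
  have h' : (W.eta L B F a ≫ IPre L B p h hh V) ≫ prI L B p' V = F := by
    rw [Category.assoc, IPre_prI, eta_prI]
  refine L.eq_of_uncurry_eq h' (W'.eta_prI L B _ _) ?_
  refine (L.uncurry_comp_curry (W.eta L B F a) _
    (by rw [Category.assoc, evI_fst, ← Category.assoc, L.fpMap_fst, Category.comp_id])
    (W.eta_prI L B F a) h').trans (Eq.trans ?_ (L.uncurry_curry _ (B.lift_fst _ _)).symm)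
  have e : L.fpMap (W.eta L B F a) (W.eta_prI L B F a) (𝟙 Ut) (Category.id_comp p) ≫
      evI L B p V = B.lift (L.fst F p ≫ F)
        (W.lift (L.fst F p) (L.snd F p) (L.isPullback F p).w ≫ a) := L.uncurry_curry _ _
  have e' : L.fpMap (W.eta L B F a) (W.eta_prI L B F a) (𝟙 Ut') (Category.id_comp p') ≫
      L.fpMap (𝟙 _) (Category.id_comp (prI L B p V)) h hh =
      L.fpMap (𝟙 X) (Category.id_comp F) h hh ≫
        L.fpMap (W.eta L B F a) (W.eta_prI L B F a) (𝟙 Ut) (Category.id_comp p) := by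
    refine (L.isPullback _ _).hom_ext ?_ ?_ <;>
      simp [reassoc_of% L.fpMap_fst, reassoc_of% L.fpMap_snd]
  rw [reassoc_of% e', e]
  refine B.hom_ext ?_ ?_
  · simp [reassoc_of% L.fpMap_fst]
  · rw [Category.assoc, B.lift_snd, B.lift_snd, ← Category.assoc, ← Category.assoc]
    congr 1
    refine W.hom_ext ?_ ?_ <;> simp [baseChange, reassoc_of% W'.lift_Q]

theorem eta_injective {X V : C} (F : X ⟶ U) :
    Function.Injective (W.eta L B F : (W.obj F ⟶ V) → (X ⟶ I L B p V)) := fun a a' h =>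
  eq_of_heq (Sigma.mk.inj ((W.etaEquiv L B X V).injective
    (show W.etaEquiv L B X V ⟨F, a⟩ = W.etaEquiv L B X V ⟨F, a'⟩ from h))).2

theorem exists_eta_eq {X V : C} {F : X ⟶ U} {g : X ⟶ I L B p V} (h : g ≫ prI L B p V = F) :
    ∃ c : W.obj F ⟶ V, W.eta L B F c = g := by
  subst h
  exact ⟨_, W.eta_etaShriek L B g⟩

/-! ### The section `Jp` on components -/

variable {W L B} {Eq : W.J0Structure} {O : W.J1Structure Eq}

/-- The pull-back along `F` of `ω : Ũ ⟶ EŨ`. -/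
abbrev J1Structure.ωPb (O : W.J1Structure Eq) {X : C} (F : X ⟶ U) :
    W.obj F ⟶ (W.universeE Eq).obj F :=
  (W.universeE Eq).baseChange W O.ω O.ω_pE F

variable (L B O) in
/-- The morphism `X ⟶ Fp` with components `η(F, a)` and `η(F, b)`. -/
def toFp {X : C} (F : X ⟶ U) (a : (W.universeE Eq).obj F ⟶ U) (b : W.obj F ⟶ Ut)
    (h : O.ωPb F ≫ a = b ≫ p) : X ⟶ Fp L B O :=
  (L.isPullback _ _).lift ((W.universeE Eq).eta L B F a) (W.eta L B F b)
    (by rw [eta_comp_IPre _ L B W, eta_comp_IMap, h])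

variable {X : C} {F : X ⟶ U} {a : (W.universeE Eq).obj F ⟶ U} {b : W.obj F ⟶ Ut}

theorem toFp_fst (h : O.ωPb F ≫ a = b ≫ p) :
    toFp L B O F a b h ≫ L.fst _ _ = (W.universeE Eq).eta L B F a :=
  (L.isPullback _ _).lift_fst _ _ _

theorem toFp_snd (h : O.ωPb F ≫ a = b ≫ p) :
    toFp L B O F a b h ≫ L.snd _ _ = W.eta L B F b :=
  (L.isPullback _ _).lift_snd _ _ _

theorem ωPb_comp_pbMap {X' : C} (f : X' ⟶ X) {F' : X' ⟶ U} (hF : f ≫ F = F') :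
    O.ωPb F' ≫ (W.universeE Eq).pbMap f hF = W.pbMap f hF ≫ O.ωPb F := by
  refine (W.universeE Eq).hom_ext ?_ ?_
  · simp [baseChange, reassoc_of% (W.universeE Eq).lift_proj]
  · simp [baseChange, reassoc_of% W.pbMap_Q]

theorem comp_toFp {X' : C} (f : X' ⟶ X) {F' : X' ⟶ U} (hF : f ≫ F = F')
    (h : O.ωPb F ≫ a = b ≫ p) :
    f ≫ toFp L B O F a b h =
      toFp L B O F' ((W.universeE Eq).pbMap f hF ≫ a) (W.pbMap f hF ≫ b)
        (by rw [reassoc_of% ωPb_comp_pbMap, h, Category.assoc]) := by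
  refine (L.isPullback _ _).hom_ext ?_ ?_
  · rw [Category.assoc, toFp_fst, toFp_fst, comp_eta]
  · rw [Category.assoc, toFp_snd, toFp_snd, comp_eta]

variable (JP : J2Structure L B O)

theorem J2Structure.Jp_comp_IMap :
    JP.Jp ≫ IMap L B (W.pE Eq) p = L.fst (IPre L B (W.pE Eq) O.ω O.ω_pE U) (IMap L B p p) := by
  have := JP.comp_coJ =≫ L.fst _ _
  simpa [coJ] using this

theorem J2Structure.Jp_comp_IPre :
    JP.Jp ≫ IPre L B (W.pE Eq) O.ω O.ω_pE Ut =
      L.snd (IPre L B (W.pE Eq) O.ω O.ω_pE U) (IMap L B p p) := by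
  have := JP.comp_coJ =≫ L.snd _ _
  simpa [coJ] using this

/-- `φ ∘ Jp` lies over `F`, because its image under `I(p)` is the first component of `φ`
(diagrammatic order). -/
theorem J2Structure.exists_diagonal (h : O.ωPb F ≫ a = b ≫ p) :
    ∃ c : (W.universeE Eq).obj F ⟶ Ut,
      (W.universeE Eq).eta L B F c = toFp L B O F a b h ≫ JP.Jp := by
  refine (W.universeE Eq).exists_eta_eq L B ?_
  rw [← IMap_prI L B (W.pE Eq) p, Category.assoc, reassoc_of% JP.Jp_comp_IMap,
    reassoc_of% toFp_fst h, eta_prI]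

/-- The diagonal filler given by `Jp` of the square formed by `b`, the pull-back of `ω`, `a` and
`p`: the morphism corresponding under `η` to the image under `Jp` of the pair `(a, b)`. -/
def J2Structure.diagonal (h : O.ωPb F ≫ a = b ≫ p) : (W.universeE Eq).obj F ⟶ Ut :=
  (JP.exists_diagonal h).choose

theorem J2Structure.eta_diagonal (h : O.ωPb F ≫ a = b ≫ p) :
    (W.universeE Eq).eta L B F (JP.diagonal h) = toFp L B O F a b h ≫ JP.Jp :=
  (JP.exists_diagonal h).choose_spec

theorem J2Structure.diagonal_comp (h : O.ωPb F ≫ a = b ≫ p) : JP.diagonal h ≫ p = a := by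
  apply (W.universeE Eq).eta_injective L B F
  rw [← eta_comp_IMap, eta_diagonal, Category.assoc, Jp_comp_IMap, toFp_fst]

theorem J2Structure.ωPb_comp_diagonal (h : O.ωPb F ≫ a = b ≫ p) :
    O.ωPb F ≫ JP.diagonal h = b := by
  apply W.eta_injective L B F
  rw [← eta_comp_IPre, eta_diagonal, Category.assoc, Jp_comp_IPre, toFp_snd]

theorem J2Structure.pbMap_comp_diagonal {X' : C} (f : X' ⟶ X) {F' : X' ⟶ U} (hF : f ≫ F = F')
    {a' : (W.universeE Eq).obj F' ⟶ U} {b' : W.obj F' ⟶ Ut} (h : O.ωPb F ≫ a = b ≫ p)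
    (h' : O.ωPb F' ≫ a' = b' ≫ p) (ha : (W.universeE Eq).pbMap f hF ≫ a = a')
    (hb : W.pbMap f hF ≫ b = b') :
    (W.universeE Eq).pbMap f hF ≫ JP.diagonal h = JP.diagonal h' := by
  subst ha hb
  apply (W.universeE Eq).eta_injective L B F'
  rw [← comp_eta, eta_diagonal, eta_diagonal, ← Category.assoc, comp_toFp _ hF]

end Universe

namespace UniverseCategory

/-! ### Canonical morphisms of `CC(𝒞, p)` -/

variable {C : Type u} [Category.{v} C] {𝒰 : UniverseCategory C}

theorem eqToHom_int_obj_proj {Γ : 𝒰.CCOb} (T : 𝒰.CCData.Ob1 Γ) :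
    eqToHom (int_obj T) ≫ 𝒰.univ.proj (u1 T) = projT T := by
  induction T using Ob1.elim with
  | h F => exact Category.id_comp _

theorem eqToHom_int_obj_Q {Γ : 𝒰.CCOb} (T : 𝒰.CCData.Ob1 Γ) :
    eqToHom (int_obj T) ≫ 𝒰.univ.Q (u1 T) = QT T := by
  induction T using Ob1.elim with
  | h F => exact Category.id_comp _

theorem intMap_qOf_QT {Δ Γ : 𝒰.CCOb} {f : Δ ⟶ Γ} {T : 𝒰.CC.Ob1 Γ} {T' : 𝒰.CC.Ob1 Δ}
    (h : 𝒰.CC.pb f T = T') : intMap (CSystem.qOf h) ≫ QT T = QT T' := by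
  subst h
  rw [CSystem.qOf_rfl]
  exact qT_QT (intMap f) T

theorem intMap_qOf_projT {Δ Γ : 𝒰.CCOb} {f : Δ ⟶ Γ} {T : 𝒰.CC.Ob1 Γ} {T' : 𝒰.CC.Ob1 Δ}
    (h : 𝒰.CC.pb f T = T') : intMap (CSystem.qOf h) ≫ projT T = projT T' ≫ intMap f :=
  (CSystem.qOf_isPullback h).w.symm

theorem u1_pb {Δ Γ : 𝒰.CCOb} (f : Δ ⟶ Γ) (T : 𝒰.CC.Ob1 Γ) :
    u1 (𝒰.CC.pb f T) = intMap f ≫ u1 T := rfl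

theorem intMap_q_eqToHom {Δ Γ : 𝒰.CCOb} (f : Δ ⟶ Γ) (T : 𝒰.CC.Ob1 Γ) :
    intMap (𝒰.CC.q f T) ≫ eqToHom (int_obj T) =
      eqToHom (int_obj (𝒰.CC.pb f T)) ≫ 𝒰.univ.pbMap (intMap f) (u1_pb f T).symm := by
  refine 𝒰.univ.hom_ext ?_ ?_
  · rw [Category.assoc, eqToHom_int_obj_proj, Category.assoc, Universe.pbMap_proj,
      reassoc_of% eqToHom_int_obj_proj]
    exact qT_projT (intMap f) T
  · rw [Category.assoc, eqToHom_int_obj_Q, Category.assoc, Universe.pbMap_Q, eqToHom_int_obj_Q]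
    exact qT_QT (intMap f) T

/-! ### The object `IdxT(T)` as a pull-back of `EŨ` -/

section

variable (Eq : 𝒰.univ.J0Structure)

/-- The equality `obj_comp_eq` of iterated pull-backs respects their projections.  The projections
to `(X; A)` and `(X; A')` are compared only after composition to `X` and to `Ũ`, which avoids a
second transport along `A = A'`. -/
theorem eqToHom_obj_comp_eq {X : C} {A A' : X ⟶ 𝒰.U} (h : A = A') {k : X ⟶ 𝒰.Ut}
    {G : 𝒰.univ.obj A ⟶ 𝒰.univ.obj 𝒰.p} {G' : 𝒰.univ.obj A' ⟶ 𝒰.univ.obj 𝒰.p}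
    (h₁ : G ≫ 𝒰.univ.proj 𝒰.p = 𝒰.univ.proj A ≫ k) (h₂ : G ≫ 𝒰.univ.Q 𝒰.p = 𝒰.univ.Q A)
    (h₁' : G' ≫ 𝒰.univ.proj 𝒰.p = 𝒰.univ.proj A' ≫ k) (h₂' : G' ≫ 𝒰.univ.Q 𝒰.p = 𝒰.univ.Q A')
    (e : 𝒰.univ.obj (G ≫ Eq) = 𝒰.univ.obj (G' ≫ Eq)) :
    eqToHom e ≫ 𝒰.univ.proj (G' ≫ Eq) ≫ 𝒰.univ.proj A' =
        𝒰.univ.proj (G ≫ Eq) ≫ 𝒰.univ.proj A ∧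
      eqToHom e ≫ 𝒰.univ.proj (G' ≫ Eq) ≫ 𝒰.univ.Q A' = 𝒰.univ.proj (G ≫ Eq) ≫ 𝒰.univ.Q A ∧
      eqToHom e ≫ 𝒰.univ.Q (G' ≫ Eq) = 𝒰.univ.Q (G ≫ Eq) := by
  subst h
  obtain rfl := 𝒰.univ.hom_ext (h₁.trans h₁'.symm) (h₂.trans h₂'.symm)
  simp

/-- The morphism underlying the equality `int(IdxT(T)) = (int(Γ); u₁(T))_E`. -/
abbrev idxHom {Γ : 𝒰.CCOb} (T : 𝒰.CC.Ob1 Γ) :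
    ((𝒰.IdTEq Eq).IdxT T).obj.int ⟶ (𝒰.univ.universeE Eq).obj (u1 T) :=
  eqToHom (int_IdxT Eq T)

/-- The identification of `int(IdxT(T))` with the pull-back of `EŨ = (Ũ; p, Eq)` along `u₁(T)`
respects the projection to `int(Γ)` and the three components in `Ũ`. -/
theorem idxHom_components {Γ : 𝒰.CCOb} (T : 𝒰.CC.Ob1 Γ) :
    idxHom Eq T ≫ (𝒰.univ.universeE Eq).proj (u1 T) =
        projT ((𝒰.IdTEq Eq).IdxT T) ≫ projT (𝒰.CC.pb (𝒰.CC.p T) T) ≫ projT T ∧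
      idxHom Eq T ≫ (𝒰.univ.universeE Eq).Q (u1 T) ≫ 𝒰.univ.proj Eq ≫ 𝒰.univ.proj 𝒰.p =
        projT ((𝒰.IdTEq Eq).IdxT T) ≫ projT (𝒰.CC.pb (𝒰.CC.p T) T) ≫ QT T ∧
      idxHom Eq T ≫ (𝒰.univ.universeE Eq).Q (u1 T) ≫ 𝒰.univ.proj Eq ≫ 𝒰.univ.Q 𝒰.p =
        projT ((𝒰.IdTEq Eq).IdxT T) ≫ QT (𝒰.CC.pb (𝒰.CC.p T) T) ∧
      idxHom Eq T ≫ (𝒰.univ.universeE Eq).Q (u1 T) ≫ 𝒰.univ.Q Eq =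
        QT ((𝒰.IdTEq Eq).IdxT T) := by
  induction T using Ob1.elim with
  | h F =>
    obtain ⟨e₁, e₂, e₃⟩ := eqToHom_obj_comp_eq Eq (k := 𝒰.univ.Q F) (𝒰.univ.isPullback F).w
      (G := uut ((CSystem.diag (S := 𝒰.CC) (ext Γ F)).pb (𝒰.CC.p (𝒰.CC.pb (𝒰.CC.p (ext Γ F)) _)))
        (CSystem.diag (S := 𝒰.CC) (𝒰.CC.pb (𝒰.CC.p (ext Γ F)) (ext Γ F))) rfl)
      ((𝒰.univ.lift_proj _ _ _).trans ((u1t_pb _ _).trans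
        (congrArg (𝒰.univ.proj _ ≫ ·) (u1t_diag (ext Γ F)))))
      ((𝒰.univ.lift_Q _ _ _).trans (u1t_diag _))
      (𝒰.univ.Qmap_proj _ _) (𝒰.univ.Qmap_Q _ _) (int_IdxT Eq (ext Γ F))
    refine ⟨?_, ?_, ?_, ?_⟩
    · have := e₁ =≫ 𝒰.univ.proj F
      simp only [Category.assoc] at this
      exact this
    · have := e₁ =≫ 𝒰.univ.Q F
      simp only [Category.assoc] at this
      refine _root_.Eq.trans ?_ this
      simp only [Universe.universeE, reassoc_of% Universe.Qmap_proj, Universe.Qmap_proj]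
      rfl
    · refine _root_.Eq.trans ?_ e₂
      simp only [Universe.universeE, reassoc_of% Universe.Qmap_proj, Universe.Qmap_Q]
      rfl
    · refine _root_.Eq.trans ?_ e₃
      simp only [Universe.universeE, Universe.Qmap_Q]
      rfl

/-- Morphisms to `int(IdxT(T))` are compared with morphisms to `(int(Γ); u₁(T))_E` by their
component in `int(Γ)` and their three components in `Ũ`. -/
theorem comp_idxHom_ext {Γ : 𝒰.CCOb} (T : 𝒰.CC.Ob1 Γ) {Y : C}
    {x : Y ⟶ ((𝒰.IdTEq Eq).IdxT T).obj.int} {y : Y ⟶ (𝒰.univ.universeE Eq).obj (u1 T)}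
    (h₁ : (x ≫ projT ((𝒰.IdTEq Eq).IdxT T) ≫ projT (𝒰.CC.pb (𝒰.CC.p T) T)) ≫ projT T =
      y ≫ (𝒰.univ.universeE Eq).proj (u1 T))
    (h₂ : (x ≫ projT ((𝒰.IdTEq Eq).IdxT T) ≫ projT (𝒰.CC.pb (𝒰.CC.p T) T)) ≫ QT T =
      (y ≫ (𝒰.univ.universeE Eq).Q (u1 T)) ≫ 𝒰.univ.proj Eq ≫ 𝒰.univ.proj 𝒰.p)
    (h₃ : (x ≫ projT ((𝒰.IdTEq Eq).IdxT T)) ≫ QT (𝒰.CC.pb (𝒰.CC.p T) T) =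
      (y ≫ (𝒰.univ.universeE Eq).Q (u1 T)) ≫ 𝒰.univ.proj Eq ≫ 𝒰.univ.Q 𝒰.p)
    (h₄ : x ≫ QT ((𝒰.IdTEq Eq).IdxT T) =
      (y ≫ (𝒰.univ.universeE Eq).Q (u1 T)) ≫ 𝒰.univ.Q Eq) :
    x ≫ idxHom Eq T = y := by
  obtain ⟨e₁, e₂, e₃, e₄⟩ := idxHom_components Eq T
  refine (𝒰.univ.universeE Eq).hom_ext ?_ (𝒰.univ.hom_ext (𝒰.univ.hom_ext ?_ ?_) ?_)
  · rw [Category.assoc, e₁, ← h₁, Category.assoc, Category.assoc]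
  · simp only [Category.assoc] at h₂ ⊢
    rw [e₂, h₂]
  · simp only [Category.assoc] at h₃ ⊢
    rw [e₃, h₃]
  · simp only [Category.assoc] at h₄ ⊢
    rw [e₄, h₄]

/-- Up to the equalities of their sources and targets, `q_3(f, T)` is the canonical morphism
between the pull-backs of `EŨ`. -/
theorem intMap_q3_idxHom {Δ Γ : 𝒰.CCOb} (f : Δ ⟶ Γ) (T : 𝒰.CC.Ob1 Γ) :
    intMap ((𝒰.IdTEq Eq).q3 f T) ≫ idxHom Eq T =
      idxHom Eq (𝒰.CC.pb f T) ≫ (𝒰.univ.universeE Eq).pbMap (intMap f) (u1_pb f T).symm := by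
  obtain ⟨e₁, e₂, e₃, e₄⟩ := idxHom_components Eq (𝒰.CC.pb f T)
  have a₁ : intMap ((𝒰.IdTEq Eq).q3 f T) ≫ projT ((𝒰.IdTEq Eq).IdxT T) =
      projT ((𝒰.IdTEq Eq).IdxT (𝒰.CC.pb f T)) ≫ intMap (CSystem.J0Structure.q2 f T) :=
    intMap_qOf_projT _
  have a₂ : intMap (CSystem.J0Structure.q2 f T) ≫ projT (𝒰.CC.pb (𝒰.CC.p T) T) =
      projT (𝒰.CC.pb (𝒰.CC.p (𝒰.CC.pb f T)) (𝒰.CC.pb f T)) ≫ intMap (𝒰.CC.q f T) :=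
    (intMap_qOf_projT _).trans (congrArg (fun g => _ ≫ intMap g) (CSystem.qOf_rfl f T))
  have a₃ : intMap (𝒰.CC.q f T) ≫ projT T = projT (𝒰.CC.pb f T) ≫ intMap f :=
    qT_projT (intMap f) T
  have b₁ : intMap ((𝒰.IdTEq Eq).q3 f T) ≫ QT ((𝒰.IdTEq Eq).IdxT T) =
      QT ((𝒰.IdTEq Eq).IdxT (𝒰.CC.pb f T)) := intMap_qOf_QT _
  have b₂ : intMap (CSystem.J0Structure.q2 f T) ≫ QT (𝒰.CC.pb (𝒰.CC.p T) T) =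
      QT (𝒰.CC.pb (𝒰.CC.p (𝒰.CC.pb f T)) (𝒰.CC.pb f T)) := intMap_qOf_QT _
  have b₃ : intMap (𝒰.CC.q f T) ≫ QT T = QT (𝒰.CC.pb f T) := qT_QT (intMap f) T
  refine comp_idxHom_ext Eq T ?_ ?_ ?_ ?_
  · simp only [Category.assoc, Universe.pbMap_proj]
    rw [reassoc_of% a₁, reassoc_of% a₂, a₃, reassoc_of% e₁]
  · simp only [Category.assoc, reassoc_of% Universe.pbMap_Q]
    rw [reassoc_of% a₁, reassoc_of% a₂, b₃, e₂]
  · simp only [Category.assoc, reassoc_of% Universe.pbMap_Q]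
    rw [reassoc_of% a₁, b₂, e₃]
  · simp only [Category.assoc, reassoc_of% Universe.pbMap_Q]
    rw [b₁, e₄]

variable {Eq} (O : 𝒰.univ.J1Structure Eq)

/-- Up to the equalities of their sources and targets, `rf_T` is the pull-back of `ω` along
`u₁(T)`. -/
theorem intMap_rf_idxHom {Γ : 𝒰.CCOb} (T : 𝒰.CC.Ob1 Γ) :
    intMap ((reflΩ O).rf T) ≫ idxHom Eq T = eqToHom (int_obj T) ≫ O.ωPb (u1 T) := by
  have hd : intMap (CSystem.diag (S := 𝒰.CC) T).s ≫ projT (𝒰.CC.pb (𝒰.CC.p T) T) = 𝟙 _ :=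
    (CSystem.diag (S := 𝒰.CC) T).w
  have hr : intMap ((reflΩ O).refl (CSystem.diag (S := 𝒰.CC) T)).s ≫
      projT ((reflΩ O).refl (CSystem.diag (S := 𝒰.CC) T)).bd = 𝟙 _ :=
    ((reflΩ O).refl (CSystem.diag (S := 𝒰.CC) T)).w
  have a₁ : intMap ((reflΩ O).rf T) ≫ projT ((𝒰.IdTEq Eq).IdxT T) =
      intMap (CSystem.diag (S := 𝒰.CC) T).s :=
    (Category.assoc (intMap ((reflΩ O).refl (CSystem.diag (S := 𝒰.CC) T)).s) _ _).trans
      ((congrArg (_ ≫ ·) (intMap_qOf_projT _)).trans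
        ((Category.assoc _ _ _).symm.trans
          ((congrArg (· ≫ intMap (CSystem.diag (S := 𝒰.CC) T).s) hr).trans (Category.id_comp _))))
  have b₁ : intMap ((reflΩ O).rf T) ≫ QT ((𝒰.IdTEq Eq).IdxT T) = QT T ≫ O.Ω :=
    (Category.assoc (intMap ((reflΩ O).refl (CSystem.diag (S := 𝒰.CC) T)).s) _ _).trans
      ((congrArg (_ ≫ ·) (intMap_qOf_QT _)).trans
        ((u1t_ofU1t _).trans (congrArg (· ≫ O.Ω) (u1t_diag T))))
  have hu : intMap (CSystem.diag (S := 𝒰.CC) T).s ≫ QT (𝒰.CC.pb (𝒰.CC.p T) T) = QT T :=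
    u1t_diag T
  have hp : O.ωPb (u1 T) ≫ (𝒰.univ.universeE Eq).proj (u1 T) = 𝒰.univ.proj (u1 T) :=
    Universe.lift_proj _ _ _ _
  have hQ : O.ωPb (u1 T) ≫ (𝒰.univ.universeE Eq).Q (u1 T) = 𝒰.univ.Q (u1 T) ≫ O.ω :=
    Universe.lift_Q _ _ _ _
  refine comp_idxHom_ext Eq T ?_ ?_ ?_ ?_
  · rw [reassoc_of% a₁, hd, Category.id_comp, Category.assoc, hp, eqToHom_int_obj_proj]
  · rw [reassoc_of% a₁, hd, Category.id_comp, Category.assoc (eqToHom _), hQ]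
    simp [Universe.J1Structure.ω, Universe.diag, reassoc_of% Universe.lift_proj,
      eqToHom_int_obj_Q]
  · rw [a₁, hu, Category.assoc (eqToHom _), hQ]
    simp [Universe.J1Structure.ω, Universe.diag, reassoc_of% Universe.lift_proj,
      eqToHom_int_obj_Q]
  · rw [b₁, Category.assoc (eqToHom _), hQ]
    simp [Universe.J1Structure.ω, reassoc_of% eqToHom_int_obj_Q]

/-! ### The J2-structure defined by `Jp` -/

variable {O}

/-- The boundary condition on `s0` says that `ũ₁(s0)` and `u₁(P)` form a commutative square with
the pull-back of `ω` and `p`. -/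
theorem ωPb_comp_eq {Γ : 𝒰.CCOb} {T : 𝒰.CC.Ob1 Γ} {P : 𝒰.CC.Ob1 ((𝒰.IdTEq Eq).IdxT T).obj}
    {s0 : 𝒰.CC.Sec T.obj} (h : s0.bd = 𝒰.CC.pb ((reflΩ O).rf T) P) :
    O.ωPb (u1 T) ≫ eqToHom (int_IdxT Eq T).symm ≫ u1 P =
      (eqToHom (int_obj T).symm ≫ u1t s0) ≫ 𝒰.p := by
  have e := (intMap_rf_idxHom O T).symm
  rw [eqToHom_comp_iff] at e
  rw [Category.assoc, u1t_p, h, u1_pb, e]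
  simp

variable {L : LCCStructure C} {B : BinaryProductStructure C}

/-- The J2-structure `J_{Jp}` on `CC(𝒞, p)`: `J(Γ, T, P, s0)` is the section of `P` given by the
diagonal filler of the square formed by `ũ₁(s0)`, `rf_T`, `u₁(P)` and `p`. -/
def jOfJp (JP : Universe.J2Structure L B O) : CSystem.J2Structure (reflΩ O) where
  J T _ _ h := ofU1t (idxHom Eq T ≫ JP.diagonal (ωPb_comp_eq h))
  bd_J {Γ} T P s0 h := by
    refine _root_.Eq.trans (congrArg (ext _) ?_) (ext_u1 P)
    rw [Category.assoc, JP.diagonal_comp]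
    simp [idxHom]
  natural {Γ' Γ} f T P s0 h := by
    apply u1t_injective
    rw [u1t_pb, u1t_ofU1t, u1t_ofU1t, reassoc_of% intMap_q3_idxHom]
    congr 1
    refine JP.pbMap_comp_diagonal (intMap f) (u1_pb f T).symm _ _ ?_ ?_
    · have e := (intMap_q3_idxHom Eq f T).symm
      rw [eqToHom_comp_iff] at e
      rw [e, u1_pb (CSystem.J0Structure.q3 _ f T)]
      simp [idxHom]
    · have e := (intMap_q_eqToHom f T).symm
      rw [eqToHom_comp_iff] at e
      rw [e, u1t_pb]
      simp
  iota {Γ} T P s0 h := by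
    apply u1t_injective
    rw [u1t_pb, u1t_ofU1t, reassoc_of% intMap_rf_idxHom, JP.ωPb_comp_diagonal]
    simp

theorem u1t_jOfJp (JP : Universe.J2Structure L B O) {Γ : 𝒰.CCOb} {T : 𝒰.CC.Ob1 Γ}
    {P : 𝒰.CC.Ob1 ((𝒰.IdTEq Eq).IdxT T).obj} {s0 : 𝒰.CC.Sec T.obj}
    (h : s0.bd = 𝒰.CC.pb ((reflΩ O).rf T) P) :
    eqToHom (int_IdxT Eq T).symm ≫ u1t ((jOfJp JP).J T P s0 h) =
      JP.diagonal (ωPb_comp_eq h) := by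
  have e : u1t ((jOfJp JP).J T P s0 h) = idxHom Eq T ≫ JP.diagonal (ωPb_comp_eq h) :=
    u1t_ofU1t _
  rw [e]
  simp [idxHom]

end

end UniverseCategory

end

theorem mainTheorem1 {C : Type u} [Category.{v} C] (𝒰 : UniverseCategory C)
    (L : LCCStructure C) (B : BinaryProductStructure C) (Eq : 𝒰.univ.J0Structure)
    (O : 𝒰.univ.J1Structure Eq) (JP : Universe.J2Structure L B O) :
    ∃! J : CSystem.J2Structure (UniverseCategory.reflΩ O),
      ∀ (Γ : 𝒰.CC.Ob) (T : 𝒰.CC.Ob1 Γ) (P : 𝒰.CC.Ob1 ((𝒰.IdTEq Eq).IdxT T).obj)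
        (s0 : 𝒰.CC.Sec T.obj) (h : s0.bd = 𝒰.CC.pb ((UniverseCategory.reflΩ O).rf T) P),
        ∃ φ : Γ.int ⟶ Universe.Fp L B O,
          φ ≫ L.fst _ _ = (𝒰.univ.universeE Eq).eta L B (UniverseCategory.u1 T)
            (eqToHom (UniverseCategory.int_IdxT Eq T).symm ≫ UniverseCategory.u1 P) ∧
          φ ≫ L.snd _ _ = 𝒰.univ.eta L B (UniverseCategory.u1 T)
            (eqToHom (UniverseCategory.int_obj T).symm ≫ UniverseCategory.u1t s0) ∧
          (𝒰.univ.universeE Eq).eta L B (UniverseCategory.u1 T)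
            (eqToHom (UniverseCategory.int_IdxT Eq T).symm ≫
              UniverseCategory.u1t (J.J T P s0 h)) = φ ≫ JP.Jp := by
  refine ⟨UniverseCategory.jOfJp JP, ?_, ?_⟩
  · intro Γ T P s0 h
    refine ⟨Universe.toFp L B O _ _ _ (UniverseCategory.ωPb_comp_eq h), Universe.toFp_fst _,
      Universe.toFp_snd _, ?_⟩
    rw [UniverseCategory.u1t_jOfJp, JP.eta_diagonal]
  · intro J hJ
    ext Γ T P s0 h
    obtain ⟨φ, h₁, h₂, h₃⟩ := hJ Γ T P s0 h
    -- The components of `φ` determine it, and `η` and `ũ₁` are injective.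
    obtain rfl : φ = Universe.toFp L B O _ _ _ (UniverseCategory.ωPb_comp_eq h) :=
      (L.isPullback _ _).hom_ext (h₁.trans (Universe.toFp_fst _).symm)
        (h₂.trans (Universe.toFp_snd _).symm)
    rw [← JP.eta_diagonal, ← UniverseCategory.u1t_jOfJp JP h] at h₃
    exact UniverseCategory.u1t_injective
      ((cancel_epi _).mp ((𝒰.univ.universeE Eq).eta_injective L B _ h₃))
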